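/- **Setting.** Let $0\le m\le n$ be integers, let $d_1,\dots,d_m$ be positive integers, $D=\operatorname{diag}(d_1,\dots,d_m)$, and let $Z=(z_{ij})$ be an $m\times n$ integer matrix such that $D\,Z[m;m]$ is skew-symmetric, where $Z[m;m]$ is formed by the first $m$ columns of $Z$. Let $\mathbb T_m$ be the $m$-regular tree whose edges are labelled by $1,\dots,m$ so that the edges at each vertex have distinct labels, with a root $v_0$. Assign to $v_0$ the matrix $Z$ and the coordinate functions $f_1,\dots,f_n\in\mathbb R(f_1,\dots,f_n)$, and to every vertex $v$ a matrix $Z_v$ and an extended cluster $f_{v,1},\dots,f_{v,n}$ (with $f_{v,j}=f_j$ for the tropic indices $j>m$), so that along an edge $(v,\bar v)$ labelled $i$, with $Z_v=(z_{kl})$, $Z_{\bar v}=(\bar z_{kl})$, one has $f_{\bar v,j}=f_{v,j}$ for $j\ne i$ and $$f_{\bar v,i}\,f_{v,i}=\prod_{z_{ik}>0}f_{v,k}^{z_{ik}}+\prod_{z_{ik}<0}f_{v,k}^{-z_{ik}},$$ $$\bar z_{kl}=-z_{kl}\ \text{ if } k=i\text{ or } l=i,\qquad \bar z_{kl}=z_{kl}+\tfrac12\bigl(|z_{ki}|z_{il}+z_{ki}|z_{il}|\bigr)\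 \text{ otherwise}.$$ Let $X_v=\{x\in\mathbb R^n: x_i\ne0\text{ for } i\le m\}$, the set of real points of $\operatorname{Spec}\mathbb R[f_{v,1}^{\pm1},\dots,f_{v,m}^{\pm1},f_{m+1},\dots,f_n]$. Let $\mathcal X=\bigcup_{v}X_v$ be obtained by gluing these charts along the birational transition maps given by expressing one extended cluster through another: $x\in X_v$ and $y\in X_u$ are identified when the transition map is regular at $x$ with value $y$ and its inverse is regular at $y$ with value $x$. Give $\mathcal X$ the quotient topology, and let $\mathcal X^0\subset\mathcal X$ be the subspace where all tropic variables $f_{m+1},\dots,f_n$ are nonzero. For a bilinear form $\eta$ on $\mathbb F_2^n$ with standard basis $e_1,\dots,e_n$, put $\mathfrak t_i(\xi)=\xi-\eta(\xi,e_i)e_i$, and let $\Gamma$ be the group generated by $\mathfrak t_1,\dots,\mathfrak t_m$. **Theorem 2.10.** Let $v$ be any vertex of $\mathbb T_m$ and $Z_v=(z_{ij})$. (1) If $\eta(e_j,e_i)=z_{ij}\bmod 2$ for all $i\in[1,m]$, $j\in[1,n]$, then the number of connected components of $\mathcal X^0$ is finite and equals the number of $\Gamma$-orbits in $\mathbb F_2^n$.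 (2) In particular, suppose that all $d_i$ are odd (for example, $Z[m;m]$ is skew-symmetric and $D$ is the identity). Let $\widehat D=\operatorname{diag}(\hat d_1,\dots,\hat d_n)=\operatorname{diag}(d_1,\dots,d_m,1,\dots,1)$, and let $Z'=(z'_{ij})$ be any $n\times n$ integer matrix with first $m$ rows $Z_v$ and with $\widehat D Z'$ skew-symmetric. If $\eta(e_i,e_j)=\hat d_i z'_{ij}\bmod 2$ for all $i,j\in[1,n]$, then the number of connected components of $\mathcal X^0$ equals the number of $\Gamma$-orbits in $\mathbb F_2^n$. -/

import Mathlib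

namespace ClusterManifold

noncomputable section

/-- `D Z[m;m]` is skew-symmetric, for `D = diag(d)`; the rows of `Z` are indexed by the cluster
indices `ι`, the columns by all indices `ι ⊕ κ` (cluster and tropic). -/
def IsSkewSymmetrizable {ι κ : Type} (d : ι → ℕ) (Z : Matrix ι (ι ⊕ κ) ℤ) : Prop :=
  ∀ i j : ι, (d i : ℤ) * Z i (Sum.inl j) = -((d j : ℤ) * Z j (Sum.inl i))

/-- The diagonal of `diag(d_1, …, d_m, 1, …, 1)`. -/
def dHat {ι κ : Type} (d : ι → ℕ) : ι ⊕ κ → ℕ := Sum.elim d (fun _ => 1)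

/-- `Z'` is a square integer matrix, skew-symmetrizable by `diag(d_1, …, d_m, 1, …, 1)`, whose
first `m` rows form `Z`. -/
def IsSquareExtension {ι κ : Type} (d : ι → ℕ) (Z : Matrix ι (ι ⊕ κ) ℤ)
    (Z' : Matrix (ι ⊕ κ) (ι ⊕ κ) ℤ) : Prop :=
  (∀ a b : ι ⊕ κ, (dHat d a : ℤ) * Z' a b = -((dHat d b : ℤ) * Z' b a)) ∧
    ∀ (i : ι) (b : ι ⊕ κ), Z' (Sum.inl i) b = Z i b

/-- The field of real rational functions in the initial cluster and tropic variables. -/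
abbrev RatFun (ι κ : Type) : Type := FractionRing (MvPolynomial (ι ⊕ κ) ℝ)

/-- An exchange matrix together with an extended cluster. -/
structure Seed (ι κ : Type) where
  Z : Matrix ι (ι ⊕ κ) ℤ
  f : ι ⊕ κ → RatFun ι κ

section Mutation

variable {ι κ : Type} [Fintype ι] [Fintype κ] [DecidableEq ι] [DecidableEq κ]

/-- The mutation of the exchange matrix in direction `i`; the division by `2` is exact. -/
def mutateMatrix (i : ι) (Z : Matrix ι (ι ⊕ κ) ℤ) : Matrix ι (ι ⊕ κ) ℤ :=
  fun k l =>
    if k = i ∨ l = Sum.inl i then -Z k l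
    else Z k l + (|Z k (Sum.inl i)| * Z i l + Z k (Sum.inl i) * |Z i l|) / 2

/-- The mutation `T_i`: the `i`-th cluster variable `f i` is replaced by
`(∏_{Z i k > 0} (f k)^(Z i k) + ∏_{Z i k < 0} (f k)^(-Z i k)) / f i`. -/
def Seed.mutate (i : ι) (s : Seed ι κ) : Seed ι κ where
  Z := mutateMatrix i s.Z
  f := Function.update s.f (Sum.inl i)
    ((∏ k, s.f k ^ (s.Z i k).toNat + ∏ k, s.f k ^ (-(s.Z i k)).toNat) / s.f (Sum.inl i))

/-- The seed reached from the initial one (whose variables are the coordinate functions) along a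
word of directions; the head of the list is the last mutation performed. -/
def seedAlong (Z : Matrix ι (ι ⊕ κ) ℤ) : List ι → Seed ι κ
  | [] => ⟨Z, fun j => algebraMap (MvPolynomial (ι ⊕ κ) ℝ) (RatFun ι κ) (MvPolynomial.X j)⟩
  | i :: w => (seedAlong Z w).mutate i

/-- Vertices of the `m`-regular tree with edges labelled by `ι`: a vertex is the word of labels on
the unique non-backtracking path from the root to it. -/
def TreeVertex (ι : Type) : Type := {w : List ι // w.IsChain (· ≠ ·)}

/-- The seed at a vertex of the tree. -/
def seedAt (Z : Matrix ι (ι ⊕ κ) ℤ) (v : TreeVertex ι) : Seed ι κ := seedAlong Z v.1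

end Mutation

section Manifold

variable {ι κ : Type}

/-- Let `f` be an extended cluster, considered as a coordinate system. The rational function `g` is
regular at the point with coordinates `x` and takes the value `a` there:
`g = p(f) / q(f)` with polynomials `p`, `q` such that `q(x) ≠ 0` and `a = p(x) / q(x)`. -/
def IsRegularWithValue (f : ι ⊕ κ → RatFun ι κ) (x : ι ⊕ κ → ℝ) (g : RatFun ι κ) (a : ℝ) : Prop :=
  ∃ p q : MvPolynomial (ι ⊕ κ) ℝ, MvPolynomial.eval x q ≠ 0 ∧
    g * MvPolynomial.aeval f q = MvPolynomial.aeval f p ∧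
    a = MvPolynomial.eval x p / MvPolynomial.eval x q

/-- Real points of `Spec ℝ[f_{v,1}^{±1}, …, f_{v,m}^{±1}, f_{m+1}, …, f_n]`, in the coordinates
`f_{v,1}, …, f_n`. -/
def Chart (ι κ : Type) : Type := {x : ι ⊕ κ → ℝ // ∀ i : ι, x (Sum.inl i) ≠ 0}

instance : TopologicalSpace (Chart ι κ) :=
  inferInstanceAs (TopologicalSpace {x : ι ⊕ κ → ℝ // ∀ i : ι, x (Sum.inl i) ≠ 0})

variable [Fintype ι] [Fintype κ] [DecidableEq ι] [DecidableEq κ]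

/-- Disjoint union of the charts over the vertices of the tree. -/
abbrev ChartPoint (ι κ : Type) : Type := Σ _ : TreeVertex ι, Chart ι κ

/-- Gluing of the charts. A point `x` of the chart at `v` is identified with a point `y` of the
chart at `u` when the birational transition map between the charts (given by the expression
of one extended cluster through the other) is regular at `x` with value `y` and its inverse is
regular at `y` with value `x`. -/
def Glued (Z : Matrix ι (ι ⊕ κ) ℤ) (P Q : ChartPoint ι κ) : Prop :=
  (∀ j, IsRegularWithValue (seedAt Z P.1).f P.2.1 ((seedAt Z Q.1).f j) (Q.2.1 j)) ∧
    (∀ j, IsRegularWithValue (seedAt Z Q.1).f Q.2.1 ((seedAt Z P.1).f j) (P.2.1 j))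

/-- The (real points of the) cluster manifold, the union of all charts, with the topology in which
a set is open exactly when its trace on each chart is open. -/
def Manifold (Z : Matrix ι (ι ⊕ κ) ℤ) : Type := Quot (Glued (κ := κ) Z)

instance (Z : Matrix ι (ι ⊕ κ) ℤ) : TopologicalSpace (Manifold Z) :=
  inferInstanceAs (TopologicalSpace (Quot (Glued (κ := κ) Z)))

/-- The part of the cluster manifold in which all tropic variables are nonzero, that is, the union
over all vertices `v` of the sets `{x ∈ X_v : f_j(x) ≠ 0 for all tropic j}`. -/
def regularPart (Z : Matrix ι (ι ⊕ κ) ℤ) : Set (Manifold Z) :=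
  {P | ∃ (v : TreeVertex ι) (x : Chart ι κ),
    (∀ j : κ, x.1 (Sum.inr j) ≠ 0) ∧ P = Quot.mk (Glued Z) ⟨v, x⟩}

end Manifold

section Transvections

variable {ι κ : Type} [DecidableEq ι] [DecidableEq κ]

/-- The vector space over the field with two elements with basis indexed by all variables. -/
abbrev F2Space (ι κ : Type) : Type := ι ⊕ κ → ZMod 2

/-- The standard basis vector `e_j`. -/
def e (j : ι ⊕ κ) : F2Space ι κ := Pi.single j 1

/-- The operator `ξ ↦ ξ - η(ξ, e_i) e_i`. -/
def transvection (η : LinearMap.BilinForm (ZMod 2) (F2Space ι κ)) (i : ι) :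
    F2Space ι κ →ₗ[ZMod 2] F2Space ι κ :=
  LinearMap.id - (η.flip (e (Sum.inl i))).smulRight (e (Sum.inl i))

/-- The group generated by the operators `transvection η i`, `i` a cluster index. -/
def transvectionGroup (η : LinearMap.BilinForm (ZMod 2) (F2Space ι κ)) :
    Subgroup (F2Space ι κ ≃ₗ[ZMod 2] F2Space ι κ) :=
  Subgroup.closure {g | ∃ i : ι, (g : F2Space ι κ →ₗ[ZMod 2] F2Space ι κ) = transvection η i}

/-- The operators are invertible, so that they do generate a group, as soon as
`η(e_i, e_i) = 0`. -/
theorem exists_equiv_eq_transvection (η : LinearMap.BilinForm (ZMod 2) (F2Space ι κ)) (i : ι)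
    (h : η (e (Sum.inl i)) (e (Sum.inl i)) = 0) :
    ∃ g ∈ transvectionGroup η,
      (g : F2Space ι κ →ₗ[ZMod 2] F2Space ι κ) = transvection η i := by
  have key : ∀ ξ, transvection η i (transvection η i ξ) = ξ := by
    intro ξ
    funext a
    have h2 : ∀ z w : ZMod 2, z - w - w = z := by decide
    simp [transvection, h, h2]
  refine ⟨LinearEquiv.ofInvolutive (transvection η i) key, Subgroup.subset_closure ⟨i, ?_⟩, ?_⟩ <;>
    rfl

/-- The number of orbits of that group. -/
def numOrbits (η : LinearMap.BilinForm (ZMod 2) (F2Space ι κ)) : ℕ :=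
  Nat.card (MulAction.orbitRel.Quotient (transvectionGroup η) (F2Space ι κ))

end Transvections

/-- The number of connected components of the regular part of the cluster manifold. -/
def numComponents {ι κ : Type} [Fintype ι] [Fintype κ] [DecidableEq ι] [DecidableEq κ]
    (Z : Matrix ι (ι ⊕ κ) ℤ) : ℕ :=
  Nat.card (ConnectedComponents (regularPart Z))

end

end ClusterManifold

/-! In each chart the regular part is a disjoint union of open orthants, indexed by sign vectors in
`𝔽₂ⁿ`. Across an edge labelled `i`, the new variable is a sum of two monomials divided by the old
one. The sign of the sum is that of one of the monomials, and inside every orthant each of these two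
signs occurs. So an orthant of one chart meets the two orthants of its neighbour obtained by adding
to `ξ_i` the sign of the first monomial (`crossing`) or of the second; these two differ by the
transvection `flip`.

Hence at the root, orthants in one flip orbit lie in one component (`orthantComponent_flip`), and
crossings carry every orthant of every chart to the root (`orthantComponent_transport`). Components
are thus a quotient of the set of orbits.

Distinct orbits give distinct components because the orbit of the transported sign vector is a
locally constant function on the regular part. Its invariance under gluing is the delicate point:
charts far apart in the tree may be glued at a point that is missing from the charts between them.
The function field is therefore ordered by embedding it into germs at generic points near the given
point. No cluster variable is zero in the field, so signs can be followed along the whole path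
(`orbitSetoid_transport_signs`), while at the two ends the signs of germs are the signs of the
coordinates.

The orbits may be counted at any vertex, since a crossing conjugates flips of the mutated matrix to
flips of `Z`, up to conjugation by the flip `i` (`crossing_flip_crossing`). -/

namespace ClusterManifold

noncomputable section

/-! ### Mutation of skew-symmetrizable matrices -/

section MatrixMutation

variable {ι κ : Type} [DecidableEq ι] [DecidableEq κ]

/-- The two terms cancel for opposite signs and coincide for equal ones. This form brings in the
positive and negative parts of `b`, which are the exponents of the exchange monomials. -/
theorem abs_mul_add_mul_abs_div_two (a b : ℤ) :
    (|a| * b + a * |b|) / 2 = if 0 ≤ a then a * b.toNat else a * (-b).toNat := by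
  rcases le_total 0 a with ha | ha <;> rcases le_total 0 b with hb | hb
  · rw [abs_of_nonneg ha, abs_of_nonneg hb, if_pos ha, Int.toNat_of_nonneg hb]; omega
  · rw [abs_of_nonneg ha, abs_of_nonpos hb, if_pos ha, Int.toNat_of_nonpos hb]; simp
  · rcases ha.eq_or_lt with rfl | ha'
    · simp
    rw [abs_of_nonpos ha, abs_of_nonneg hb, if_neg (by omega), Int.toNat_of_nonpos (by omega)]
    simp
  · rcases ha.eq_or_lt with rfl | ha'
    · simp
    rw [abs_of_nonpos ha, abs_of_nonpos hb, if_neg (by omega), Int.toNat_of_nonneg (by omega)]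
    have : -a * b + a * -b = (a * -b) * 2 := by ring
    rw [this, Int.mul_ediv_cancel _ (by norm_num)]

variable {d : ι → ℕ} {Z : Matrix ι (ι ⊕ κ) ℤ}

omit [DecidableEq ι] [DecidableEq κ] in
theorem IsSkewSymmetrizable.diag_eq_zero (hd : ∀ i, 0 < d i) (hZ : IsSkewSymmetrizable d Z)
    (i : ι) : Z i (Sum.inl i) = 0 := by
  have h := hZ i i
  have h0 : (d i : ℤ) * Z i (Sum.inl i) = 0 := by linarith
  exact (mul_eq_zero.1 h0).resolve_left (by exact_mod_cast (hd i).ne')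

omit [DecidableEq ι] [DecidableEq κ] in
theorem IsSkewSymmetrizable.pos_iff_neg (hd : ∀ i, 0 < d i) (hZ : IsSkewSymmetrizable d Z)
    (i j : ι) : 0 < Z i (Sum.inl j) ↔ Z j (Sum.inl i) < 0 := by
  have h := hZ i j
  have hi : (0 : ℤ) < d i := by exact_mod_cast hd i
  have hj : (0 : ℤ) < d j := by exact_mod_cast hd j
  constructor <;> intro h' <;> by_contra hc <;> nlinarith

/-- Entries in symmetric positions have opposite signs, so off row and column `i` the corrections at
`(k, l)` and `(l, k)` both vanish unless `z_ki` and `z_li` have strictly opposite signs. In those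
two cases skew-symmetry follows from the relations for `(k, i)` and `(l, i)`. -/
theorem IsSkewSymmetrizable.mutateMatrix (hd : ∀ i, 0 < d i) (hZ : IsSkewSymmetrizable d Z)
    (i : ι) : IsSkewSymmetrizable d (mutateMatrix i Z) := by
  intro k l
  unfold ClusterManifold.mutateMatrix
  have hkl := hZ k l
  by_cases hk : k = i
  · simp [hk]; subst hk; linarith
  by_cases hl : l = i
  · simp [hl]; subst hl; linarith
  simp only [hk, hl, Sum.inl.injEq, or_self, if_false, abs_mul_add_mul_abs_div_two]
  have h1 := hZ k i
  have h2 := hZ l i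
  have p1 := hZ.pos_iff_neg hd k i
  have p2 := hZ.pos_iff_neg hd l i
  have p3 := hZ.pos_iff_neg hd i k
  have p4 := hZ.pos_iff_neg hd i l
  rcases lt_trichotomy (Z k (Sum.inl i)) 0 with ha | ha | ha <;>
  rcases lt_trichotomy (Z l (Sum.inl i)) 0 with hb | hb | hb
  · have e1 := p3.2 ha
    have e2 := p4.2 hb
    rw [if_neg (by omega), if_neg (by omega), Int.toNat_of_nonpos (by omega),
      Int.toNat_of_nonpos (by omega)]
    simpa using hkl
  · have e1 := p3.2 ha
    rw [if_neg (by omega), hb, Int.toNat_of_nonpos (z := -Z i (Sum.inl l)) (by omega)]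
    simpa using hkl
  · have e1 := p3.2 ha
    have e2 := p2.1 hb
    rw [if_neg (by omega), if_pos (by omega), Int.toNat_of_nonneg (by omega),
      Int.toNat_of_nonneg (by omega)]
    linear_combination hkl - (Z i (Sum.inl l)) * h1 + (Z i (Sum.inl k)) * h2
  · have e2 := p4.2 hb
    rw [ha, if_pos le_rfl, if_neg (by omega), Int.toNat_of_nonpos (z := -Z i (Sum.inl k)) (by omega)]
    simpa using hkl
  · rw [ha, hb]; simpa using hkl
  · have e2 := p2.1 hb
    rw [ha, if_pos (by omega), if_pos (by omega),
      Int.toNat_of_nonpos (z := Z i (Sum.inl k)) (by omega)]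
    simpa using hkl
  · have e1 := p1.1 ha
    have e2 := p4.2 hb
    rw [if_pos (by omega), if_neg (by omega), Int.toNat_of_nonneg (by omega),
      Int.toNat_of_nonneg (by omega)]
    linear_combination hkl + (Z i (Sum.inl l)) * h1 - (Z i (Sum.inl k)) * h2
  · have e1 := p1.1 ha
    rw [hb, if_pos (by omega), Int.toNat_of_nonpos (z := Z i (Sum.inl l)) (by omega)]
    simpa using hkl
  · have e1 := p1.1 ha
    have e2 := p2.1 hb
    rw [if_pos (by omega), if_pos (by omega), Int.toNat_of_nonpos (by omega),
      Int.toNat_of_nonpos (by omega)]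
    simpa using hkl

end MatrixMutation

/-! ### Flips, crossings and their orbits on sign vectors -/

section Flips

variable {ι κ : Type} [Fintype ι] [Fintype κ] [DecidableEq ι] [DecidableEq κ]

theorem IsSkewSymmetrizable.seedAlong {d : ι → ℕ} {Z : Matrix ι (ι ⊕ κ) ℤ} (hd : ∀ i, 0 < d i)
    (hZ : IsSkewSymmetrizable d Z) : ∀ w : List ι, IsSkewSymmetrizable d (seedAlong Z w).Z
  | [] => hZ
  | i :: w => (IsSkewSymmetrizable.seedAlong hd hZ w).mutateMatrix hd i

/-- The sum `∑ z_ik ξ_k` modulo `2`. -/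
def rowSum (Z : Matrix ι (ι ⊕ κ) ℤ) (i : ι) (ξ : F2Space ι κ) : ZMod 2 :=
  ∑ k, (Z i k : ZMod 2) * ξ k

/-- The sum of `z_ik ξ_k` over positive `z_ik`, modulo `2`. -/
def posSum (Z : Matrix ι (ι ⊕ κ) ℤ) (i : ι) (ξ : F2Space ι κ) : ZMod 2 :=
  ∑ k, ((Z i k).toNat : ZMod 2) * ξ k

/-- The sum of `-z_ik ξ_k` over negative `z_ik`, modulo `2`. -/
def negSum (Z : Matrix ι (ι ⊕ κ) ℤ) (i : ι) (ξ : F2Space ι κ) : ZMod 2 :=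
  ∑ k, ((-Z i k).toNat : ZMod 2) * ξ k

/-- The transvection `ξ ↦ ξ + (∑ z_ik ξ_k) e_i`. -/
def flip (Z : Matrix ι (ι ⊕ κ) ℤ) (i : ι) (ξ : F2Space ι κ) : F2Space ι κ :=
  ξ + Pi.single (Sum.inl i) (rowSum Z i ξ)

/-- The change of signs `ξ ↦ ξ + (∑_{z_ik > 0} z_ik ξ_k) e_i` under the exchange
in direction `i`, when the first monomial of the exchange relation dominates. -/
def crossing (Z : Matrix ι (ι ⊕ κ) ℤ) (i : ι) (ξ : F2Space ι κ) : F2Space ι κ :=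
  ξ + Pi.single (Sum.inl i) (posSum Z i ξ)

variable (Z : Matrix ι (ι ⊕ κ) ℤ) (i : ι) (ξ : F2Space ι κ)

theorem intCast_add_toNat_zmod_two (a : ℤ) :
    (a : ZMod 2) + (a.toNat : ZMod 2) = ((-a).toNat : ZMod 2) := by
  have h2 : ∀ z : ZMod 2, z + z = 0 := by decide
  have h : a = (a.toNat : ℤ) - ((-a).toNat : ℤ) := by omega
  have h' : (a : ZMod 2) = (a.toNat : ZMod 2) - ((-a).toNat : ZMod 2) := by
    exact_mod_cast congrArg (Int.cast : ℤ → ZMod 2) h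
  rw [h']
  linear_combination h2 (a.toNat : ZMod 2) - h2 ((-a).toNat : ZMod 2)

omit [DecidableEq ι] [DecidableEq κ] in
theorem rowSum_add_posSum : rowSum Z i ξ + posSum Z i ξ = negSum Z i ξ := by
  simp only [rowSum, posSum, negSum, ← Finset.sum_add_distrib, ← add_mul,
    intCast_add_toNat_zmod_two]

omit [DecidableEq ι] [DecidableEq κ] in
theorem posSum_add_negSum : posSum Z i ξ + negSum Z i ξ = rowSum Z i ξ := by
  have h2 : ∀ z w : ZMod 2, z + (w + z) = w := by decide
  rw [← rowSum_add_posSum, h2]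

theorem rowSum_add_single (j : ι) (a : ZMod 2) :
    rowSum Z i (ξ + Pi.single (Sum.inl j) a) = rowSum Z i ξ + Z i (Sum.inl j) * a := by
  simp [rowSum, mul_add, Finset.sum_add_distrib, Pi.single_apply]

theorem posSum_add_single (hi : Z i (Sum.inl i) = 0) (a : ZMod 2) :
    posSum Z i (ξ + Pi.single (Sum.inl i) a) = posSum Z i ξ := by
  simp [posSum, mul_add, Finset.sum_add_distrib, Pi.single_apply, hi]

variable {Z i}

theorem crossing_crossing (hi : Z i (Sum.inl i) = 0) : crossing Z i (crossing Z i ξ) = ξ := by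
  have h2 : ∀ z : ZMod 2, z + z = 0 := by decide
  rw [crossing, crossing, posSum_add_single _ _ _ hi, add_assoc, ← Pi.single_add, h2]
  simp

theorem flip_flip (hi : Z i (Sum.inl i) = 0) : flip Z i (flip Z i ξ) = ξ := by
  have h2 : ∀ z : ZMod 2, z + z = 0 := by decide
  rw [flip, flip, rowSum_add_single, hi, add_assoc, ← Pi.single_add]
  simp [h2]

/-- A crossing followed by a flip is the change of signs when the second monomial dominates. -/
theorem flip_crossing (hi : Z i (Sum.inl i) = 0) :
    flip Z i (crossing Z i ξ) = ξ + Pi.single (Sum.inl i) (negSum Z i ξ) := by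
  rw [crossing, flip, rowSum_add_single, hi, add_assoc, ← Pi.single_add, ← rowSum_add_posSum,
    add_comm (posSum Z i ξ)]
  simp

/-- For `j ≠ i`, mutation adds `z_ji` times `posSum` or `negSum` of row `i`, according to the sign
of `z_ji`, and the changed coordinate `i` contributes `z_ji` times `posSum`. Modulo 2 these cancel
or add up to `z_ji` times `rowSum`. -/
theorem rowSum_mutateMatrix_crossing {j : ι} (hi : Z i (Sum.inl i) = 0) :
    rowSum (mutateMatrix i Z) j (crossing Z i ξ) =
      if 0 ≤ Z j (Sum.inl i) then rowSum Z j ξ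
      else rowSum Z j ξ + Z j (Sum.inl i) * rowSum Z i ξ := by
  have h2 : ∀ z : ZMod 2, z + z = 0 := by decide
  have hneg : ∀ z : ZMod 2, -z = z := by decide
  rw [crossing, rowSum_add_single]
  have hm : mutateMatrix i Z j (Sum.inl i) = -Z j (Sum.inl i) := by simp [mutateMatrix]
  rw [hm, Int.cast_neg, hneg]
  by_cases hj : j = i
  · subst hj
    rw [hi]
    simp only [rowSum, mutateMatrix, true_or, if_true, Int.cast_neg, hneg]
    simp
  have key : ∀ k, (mutateMatrix i Z j k : ZMod 2) * ξ k =
      (Z j k : ZMod 2) * ξ k + Z j (Sum.inl i) * (if 0 ≤ Z j (Sum.inl i) then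
        ((Z i k).toNat : ZMod 2) * ξ k else ((-Z i k).toNat : ZMod 2) * ξ k) := by
    intro k
    by_cases hk : k = Sum.inl i
    · subst hk
      simp [hm, hi, hneg]
    · simp only [mutateMatrix, hj, hk, or_self, if_false, abs_mul_add_mul_abs_div_two]
      split_ifs <;> push_cast <;> ring
  simp only [rowSum, key, Finset.sum_add_distrib, ← Finset.mul_sum]
  change rowSum Z j ξ + _ + _ = _
  split_ifs
  · change rowSum Z j ξ + _ * posSum Z i ξ + _ = rowSum Z j ξ
    rw [add_assoc, h2, add_zero]
  · change rowSum Z j ξ + _ * negSum Z i ξ + _ = rowSum Z j ξ + _ * rowSum Z i ξ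
    rw [← posSum_add_negSum Z i]; ring

/-- A flip of the mutated matrix is conjugate, by the crossing, to a flip of the matrix itself, or
to the conjugate of such a flip by the flip in the direction of the mutation. -/
theorem crossing_flip_crossing {d : ι → ℕ} (hd : ∀ i, 0 < d i) (hZ : IsSkewSymmetrizable d Z)
    (i j : ι) (ξ : F2Space ι κ) :
    crossing Z i (flip (mutateMatrix i Z) j (crossing Z i ξ)) =
      if 0 ≤ Z j (Sum.inl i) then flip Z j ξ else flip Z i (flip Z j (flip Z i ξ)) := by
  have h2 : ∀ z : ZMod 2, z + z = 0 := by decide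
  have hi := hZ.diag_eq_zero hd i
  have lin : ∀ r : ZMod 2, crossing Z i (crossing Z i ξ + Pi.single (Sum.inl j) r) =
      ξ + Pi.single (Sum.inl j) r +
        Pi.single (Sum.inl i) (((Z i (Sum.inl j)).toNat : ZMod 2) * r) := by
    intro r
    have hp : posSum Z i (crossing Z i ξ + Pi.single (Sum.inl j) r) =
        posSum Z i ξ + ((Z i (Sum.inl j)).toNat : ZMod 2) * r := by
      conv_rhs => rw [← posSum_add_single Z i ξ hi (posSum Z i ξ), ← crossing]
      simp [posSum, mul_add, Finset.sum_add_distrib, Pi.single_apply]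
    have h0 : (Pi.single (Sum.inl i) (posSum Z i ξ) : F2Space ι κ) +
        Pi.single (Sum.inl i) (posSum Z i ξ) = 0 := by
      rw [← Pi.single_add, h2, Pi.single_zero]
    rw [crossing, hp, crossing, Pi.single_add]
    linear_combination (exp := 1) h0
  rw [flip, rowSum_mutateMatrix_crossing ξ hi, lin]
  have hp := hZ.pos_iff_neg hd i j
  -- For `z_ji ≥ 0` the entry `z_ij` is nonpositive, so the second crossing adds nothing along
  -- `e_i`. Otherwise `z_ij > 0`, and the extra term is the one produced by conjugation with the
  -- flip `i`.
  by_cases h : 0 ≤ Z j (Sum.inl i)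
  · rw [if_pos h, if_pos h, Int.toNat_of_nonpos (by omega), flip]
    simp
  · rw [if_neg h, if_neg h]
    have hz : ((Z i (Sum.inl j)).toNat : ZMod 2) = (Z i (Sum.inl j) : ZMod 2) := by
      have h1 : ((Z i (Sum.inl j)).toNat : ℤ) = Z i (Sum.inl j) := Int.toNat_of_nonneg (by omega)
      exact_mod_cast congrArg (Int.cast : ℤ → ZMod 2) h1
    have h0 : (Pi.single (Sum.inl i) (rowSum Z i ξ) : F2Space ι κ) +
        Pi.single (Sum.inl i) (rowSum Z i ξ) = 0 := by
      rw [← Pi.single_add, h2, Pi.single_zero]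
    have e1 : flip Z j (flip Z i ξ) = flip Z i ξ +
        Pi.single (Sum.inl j) (rowSum Z j ξ + Z j (Sum.inl i) * rowSum Z i ξ) := by
      rw [flip, flip, rowSum_add_single]
    rw [hz, e1, flip, rowSum_add_single, flip, rowSum_add_single, hi]
    have h3 : ∀ a b : ZMod 2, (Pi.single (Sum.inl i) (a + b) : F2Space ι κ) =
        Pi.single (Sum.inl i) a + Pi.single (Sum.inl i) b := fun a b => Pi.single_add _ _ _
    rw [Int.cast_zero, zero_mul, add_zero, h3 (rowSum Z i ξ)]
    linear_combination (exp := 1) -h0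

/-- The equivalence relation generated by the flips of `Z`. -/
def orbitSetoid (Z : Matrix ι (ι ⊕ κ) ℤ) : Setoid (F2Space ι κ) :=
  Relation.EqvGen.setoid fun ξ ζ => ∃ i, ζ = flip Z i ξ

theorem orbitSetoid_flip (Z : Matrix ι (ι ⊕ κ) ℤ) (i : ι) (ξ : F2Space ι κ) :
    orbitSetoid Z ξ (flip Z i ξ) :=
  Relation.EqvGen.rel _ _ ⟨i, rfl⟩

/-- The relation generated by flips is contained in every equivalence relation containing them. -/
theorem orbitSetoid_le {Z : Matrix ι (ι ⊕ κ) ℤ} {r : Setoid (F2Space ι κ)}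
    (h : ∀ i ξ, r ξ (flip Z i ξ)) {ξ ζ : F2Space ι κ} (hr : orbitSetoid Z ξ ζ) : r ξ ζ := by
  have hr' : Relation.EqvGen (fun ξ ζ => ∃ i, ζ = flip Z i ξ) ξ ζ := hr
  induction hr' with
  | rel a b hab => obtain ⟨i, rfl⟩ := hab; exact h i a
  | refl a => exact r.refl' a
  | symm a b hab ih => exact r.symm' (ih hab)
  | trans a b c hab hbc ih1 ih2 => exact r.trans' (ih1 hab) (ih2 hbc)

/-- Conjugation by the involution `crossing` turns each generator on either side into a word in the
generators on the other side. -/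
theorem orbitSetoid_crossing_iff {d : ι → ℕ} (hd : ∀ i, 0 < d i) (hZ : IsSkewSymmetrizable d Z)
    (i : ι) (ξ ζ : F2Space ι κ) :
    orbitSetoid Z (crossing Z i ξ) (crossing Z i ζ) ↔ orbitSetoid (mutateMatrix i Z) ξ ζ := by
  have hi := hZ.diag_eq_zero hd i
  have conj : ∀ j ξ, crossing Z i (flip (mutateMatrix i Z) j ξ) =
      if 0 ≤ Z j (Sum.inl i) then flip Z j (crossing Z i ξ)
      else flip Z i (flip Z j (flip Z i (crossing Z i ξ))) := by
    intro j ξ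
    rw [← crossing_flip_crossing hd hZ, crossing_crossing _ hi]
  constructor
  · intro h
    suffices H : ∀ ξ ζ, orbitSetoid Z ξ ζ →
        orbitSetoid (mutateMatrix i Z) (crossing Z i ξ) (crossing Z i ζ) by
      simpa only [crossing_crossing _ hi] using H _ _ h
    intro ξ ζ h
    refine orbitSetoid_le (r := (orbitSetoid (mutateMatrix i Z)).comap (crossing Z i))
      (fun j ξ => ?_) h
    change orbitSetoid (mutateMatrix i Z) _ _
    have ci : ∀ ξ, crossing Z i (flip Z i ξ) = flip (mutateMatrix i Z) i (crossing Z i ξ) := by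
      intro ξ
      have := crossing_flip_crossing hd hZ i i ξ
      rw [if_pos hi.ge] at this
      rw [← this, crossing_crossing _ hi]
    have cj := crossing_flip_crossing hd hZ i j
    by_cases hj : 0 ≤ Z j (Sum.inl i)
    · simp only [if_pos hj] at cj
      rw [← cj, crossing_crossing _ hi]
      exact orbitSetoid_flip _ _ _
    · simp only [if_neg hj] at cj
      -- The conjugation identity is solved for `flip Z j` by cancelling the involution `flip Z i`
      -- on both sides.
      have e : flip Z j ξ =
          flip Z i (crossing Z i (flip (mutateMatrix i Z) j (crossing Z i (flip Z i ξ)))) := by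
        rw [cj, flip_flip _ hi, flip_flip _ hi]
      rw [e, ci, crossing_crossing _ hi, ci]
      exact (orbitSetoid _).trans' (orbitSetoid_flip _ i _)
        ((orbitSetoid _).trans' (orbitSetoid_flip _ j _) (orbitSetoid_flip _ i _))
  · intro h
    refine orbitSetoid_le (r := (orbitSetoid Z).comap (crossing Z i)) (fun j ξ => ?_) h
    change orbitSetoid Z _ _
    rw [conj]
    split_ifs
    · exact orbitSetoid_flip _ _ _
    · exact (orbitSetoid _).trans' (orbitSetoid_flip _ i _)
        ((orbitSetoid _).trans' (orbitSetoid_flip _ j _) (orbitSetoid_flip _ i _))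

/-- The composition of crossings along the path from the vertex to the root. -/
def transport (Z : Matrix ι (ι ⊕ κ) ℤ) : List ι → F2Space ι κ → F2Space ι κ
  | [], ξ => ξ
  | i :: w, ξ => transport Z w (crossing (seedAlong Z w).Z i ξ)

theorem transport_bijective {d : ι → ℕ} (hd : ∀ i, 0 < d i) (hZ : IsSkewSymmetrizable d Z) :
    ∀ w, Function.Bijective (transport Z w)
  | [] => Function.bijective_id
  | i :: w => (transport_bijective hd hZ w).comp (Function.Involutive.bijective fun ξ =>
      crossing_crossing ξ ((hZ.seedAlong hd w).diag_eq_zero hd i))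

theorem orbitSetoid_transport_iff {d : ι → ℕ} (hd : ∀ i, 0 < d i) (hZ : IsSkewSymmetrizable d Z) :
    ∀ (w : List ι) (ξ ζ : F2Space ι κ), orbitSetoid Z (transport Z w ξ) (transport Z w ζ) ↔
      orbitSetoid (seedAlong Z w).Z ξ ζ
  | [], _, _ => Iff.rfl
  | i :: w, _, _ => (orbitSetoid_transport_iff hd hZ w _ _).trans
      (orbitSetoid_crossing_iff hd (hZ.seedAlong hd w) i _ _)

theorem card_quotient_orbitSetoid_seedAlong {d : ι → ℕ} (hd : ∀ i, 0 < d i)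
    (hZ : IsSkewSymmetrizable d Z) (w : List ι) :
    Nat.card (Quotient (orbitSetoid (seedAlong Z w).Z)) = Nat.card (Quotient (orbitSetoid Z)) :=
  Nat.card_congr (Quotient.congr (Equiv.ofBijective _ (transport_bijective hd hZ w)) fun ξ ζ =>
    (orbitSetoid_transport_iff hd hZ w ξ ζ).symm)

theorem transvection_apply_eq_flip {η : LinearMap.BilinForm (ZMod 2) (F2Space ι κ)}
    (hη : ∀ i j, η (e j) (e (Sum.inl i)) = (Z i j : ZMod 2)) (i : ι) (ξ : F2Space ι κ) :
    transvection η i ξ = flip Z i ξ := by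
  have hneg : ∀ z w : ZMod 2, z - w = z + w := by decide
  have hξ : ξ = ∑ k, ξ k • e k := by
    funext a
    simp [e, Finset.sum_apply, Pi.single_apply]
  have h : η ξ (e (Sum.inl i)) = rowSum Z i ξ := by
    conv_lhs => rw [hξ]
    simp [hη, rowSum, mul_comm]
  funext a
  by_cases ha : a = Sum.inl i
  · subst ha
    simp [transvection, flip, h, hneg]
    simp [e]
  · simp [transvection, flip, e, ha]

/-- Being an equivalence relation, `orbitSetoid` absorbs products and inverses of the generators. -/
theorem numOrbits_eq_card_quotient {η : LinearMap.BilinForm (ZMod 2) (F2Space ι κ)}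
    (hη : ∀ i j, η (e j) (e (Sum.inl i)) = (Z i j : ZMod 2)) (hz : ∀ i, Z i (Sum.inl i) = 0) :
    numOrbits η = Nat.card (Quotient (orbitSetoid Z)) := by
  refine Nat.card_congr (Quotient.congr (Equiv.refl _) fun ξ ζ => ?_)
  change ξ ∈ MulAction.orbit (transvectionGroup η) ζ ↔ orbitSetoid Z ξ ζ
  constructor
  · rintro ⟨⟨g, hg⟩, rfl⟩
    suffices H : ∀ ζ, orbitSetoid Z (g ζ) ζ from H ζ
    refine Subgroup.closure_induction (p := fun g _ => ∀ ζ, orbitSetoid Z (g ζ) ζ)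
      ?_ ?_ ?_ ?_ hg
    · rintro g ⟨i, hi⟩ ζ
      have : g ζ = flip Z i ζ := by
        rw [← transvection_apply_eq_flip hη, ← hi]; rfl
      rw [this]
      exact (orbitSetoid Z).symm' (orbitSetoid_flip Z i ζ)
    · intro ζ; exact (orbitSetoid Z).refl' _
    · intro g h _ _ h1 h2 ζ
      exact (orbitSetoid Z).trans' (h1 (h ζ)) (h2 ζ)
    · intro g _ h1 ζ
      have := (orbitSetoid Z).symm' (h1 (g⁻¹ ζ))
      rwa [← LinearEquiv.mul_apply, mul_inv_cancel, LinearEquiv.coe_one, id] at this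
  · refine orbitSetoid_le (r := MulAction.orbitRel (transvectionGroup η) (F2Space ι κ))
      fun i ξ => ?_
    obtain ⟨g, hg, hgi⟩ := exists_equiv_eq_transvection η i (by rw [hη, hz, Int.cast_zero])
    refine (MulAction.orbitRel _ _).symm' ⟨⟨g, hg⟩, ?_⟩
    rw [← transvection_apply_eq_flip hη, ← hgi]; rfl

end Flips

end

end ClusterManifold

namespace ClusterManifold

noncomputable section

/-! ### Signs in ordered fields -/

section Signs

variable {L : Type*} [Field L] [LinearOrder L]

/-- The sign of a nonzero element of an ordered field, as an element of `𝔽₂`. -/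
def signBit (a : L) : ZMod 2 := if a < 0 then 1 else 0

theorem signBit_of_pos {a : L} (h : 0 < a) : signBit a = 0 := if_neg h.not_gt

theorem signBit_of_neg {a : L} (h : a < 0) : signBit a = 1 := if_pos h

variable [IsStrictOrderedRing L]

theorem signBit_mul {a b : L} (ha : a ≠ 0) (hb : b ≠ 0) :
    signBit (a * b) = signBit a + signBit b := by
  rcases ha.lt_or_gt with ha | ha <;> rcases hb.lt_or_gt with hb | hb
  · rw [signBit_of_neg ha, signBit_of_neg hb, signBit_of_pos (mul_pos_of_neg_of_neg ha hb)]; rfl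
  · rw [signBit_of_neg ha, signBit_of_pos hb, signBit_of_neg (mul_neg_of_neg_of_pos ha hb)]; rfl
  · rw [signBit_of_pos ha, signBit_of_neg hb, signBit_of_neg (mul_neg_of_pos_of_neg ha hb)]; rfl
  · rw [signBit_of_pos ha, signBit_of_pos hb, signBit_of_pos (mul_pos ha hb)]; rfl

theorem signBit_pow {a : L} (ha : a ≠ 0) (n : ℕ) : signBit (a ^ n) = n * signBit a := by
  induction n with
  | zero => simp [signBit_of_pos]
  | succ n ih => rw [pow_succ, signBit_mul (pow_ne_zero _ ha) ha, ih]; push_cast; ring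

theorem signBit_prod_pow {σ : Type*} (s : Finset σ) {a : σ → L} (ha : ∀ k, a k ≠ 0) (n : σ → ℕ) :
    signBit (∏ k ∈ s, a k ^ n k) = ∑ k ∈ s, (n k : ZMod 2) * signBit (a k) := by
  classical
  induction s using Finset.induction_on with
  | empty => simp [signBit_of_pos]
  | insert k s hk ih =>
    rw [Finset.prod_insert hk, Finset.sum_insert hk, signBit_mul (pow_ne_zero _ (ha k))
      (Finset.prod_ne_zero_iff.2 fun j _ => pow_ne_zero _ (ha j)), ih, signBit_pow (ha k)]

theorem signBit_add_of_abs_lt {a b : L} (h : |b| < |a|) : signBit (a + b) = signBit a := by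
  have ha : a ≠ 0 := by rintro rfl; simp at h; exact absurd h (abs_nonneg b).not_gt
  rcases ha.lt_or_gt with ha | ha
  · rw [signBit_of_neg ha, signBit_of_neg]
    rw [abs_of_neg ha] at h
    linarith [le_abs_self b]
  · rw [signBit_of_pos ha, signBit_of_pos]
    rw [abs_of_pos ha] at h
    linarith [neg_abs_le b]

/-- Zero has bit `0`, so equal bits mean both negative or both nonnegative, and no nonvanishing is
needed. -/
theorem signBit_add_of_signBit_eq {a b : L} (h : signBit a = signBit b) :
    signBit (a + b) = signBit a := by
  unfold signBit at *
  by_cases ha : a < 0 <;> by_cases hb : b < 0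
  · simp [ha, add_neg ha hb]
  · simp [ha, hb] at h
  · simp [ha, hb] at h
  · simp [ha, add_nonneg (not_lt.1 ha) (not_lt.1 hb)]

theorem signBit_add_or {a b : L} : signBit (a + b) = signBit a ∨ signBit (a + b) = signBit b := by
  by_cases h : signBit a = signBit b
  · exact Or.inl (signBit_add_of_signBit_eq h)
  · have : ∀ x y z : ZMod 2, x ≠ y → z = x ∨ z = y := by decide
    exact this _ _ _ h

end Signs

/-! ### The exchange relation and its effect on signs -/

section Exchange

variable {ι κ : Type} [Fintype ι] [Fintype κ]

/-- The first monomial of the exchange relation. -/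
def posMonomial {R : Type*} [CommSemiring R] (Z : Matrix ι (ι ⊕ κ) ℤ) (i : ι) (x : ι ⊕ κ → R) : R :=
  ∏ k, x k ^ (Z i k).toNat

/-- The second monomial of the exchange relation. -/
def negMonomial {R : Type*} [CommSemiring R] (Z : Matrix ι (ι ⊕ κ) ℤ) (i : ι) (x : ι ⊕ κ → R) : R :=
  ∏ k, x k ^ (-(Z i k)).toNat

theorem map_posMonomial {R S F : Type*} [CommSemiring R] [CommSemiring S] [FunLike F R S]
    [RingHomClass F R S] (φ : F) (Z : Matrix ι (ι ⊕ κ) ℤ) (i : ι) (x : ι ⊕ κ → R) :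
    φ (posMonomial Z i x) = posMonomial Z i fun k => φ (x k) := by
  simp [posMonomial, map_prod]

theorem map_negMonomial {R S F : Type*} [CommSemiring R] [CommSemiring S] [FunLike F R S]
    [RingHomClass F R S] (φ : F) (Z : Matrix ι (ι ⊕ κ) ℤ) (i : ι) (x : ι ⊕ κ → R) :
    φ (negMonomial Z i x) = negMonomial Z i fun k => φ (x k) := by
  simp [negMonomial, map_prod]

variable [DecidableEq ι] [DecidableEq κ]

theorem posMonomial_update {R : Type*} [CommSemiring R] {Z : Matrix ι (ι ⊕ κ) ℤ} {i : ι}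
    (hi : Z i (Sum.inl i) = 0) (x : ι ⊕ κ → R) (a : R) :
    posMonomial Z i (Function.update x (Sum.inl i) a) = posMonomial Z i x := by
  refine Finset.prod_congr rfl fun k _ => ?_
  by_cases hk : k = Sum.inl i
  · subst hk; simp [hi]
  · rw [Function.update_of_ne hk]

theorem negMonomial_update {R : Type*} [CommSemiring R] {Z : Matrix ι (ι ⊕ κ) ℤ} {i : ι}
    (hi : Z i (Sum.inl i) = 0) (x : ι ⊕ κ → R) (a : R) :
    negMonomial Z i (Function.update x (Sum.inl i) a) = negMonomial Z i x := by
  refine Finset.prod_congr rfl fun k _ => ?_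
  by_cases hk : k = Sum.inl i
  · subst hk; simp [hi]
  · rw [Function.update_of_ne hk]

variable {L : Type*} [Field L]

/-- The values of a cluster at a point, from the values `y` of the adjacent cluster. -/
def exchange (Z : Matrix ι (ι ⊕ κ) ℤ) (i : ι) (y : ι ⊕ κ → L) : ι ⊕ κ → L :=
  Function.update y (Sum.inl i) ((posMonomial Z i y + negMonomial Z i y) / y (Sum.inl i))

/-- As `z_ii = 0`, the monomials do not involve the `i`-th variable, so the relation is symmetric in
the old and the new variable and the same row serves both directions. -/
theorem exchange_exchange {Z : Matrix ι (ι ⊕ κ) ℤ} {i : ι} (hi : Z i (Sum.inl i) = 0)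
    {y : ι ⊕ κ → L} (hy : y (Sum.inl i) ≠ 0) (h0 : posMonomial Z i y + negMonomial Z i y ≠ 0) :
    exchange Z i (exchange Z i y) = y := by
  funext k
  by_cases hk : k = Sum.inl i
  · subst hk
    simp only [exchange, Function.update_self, posMonomial_update hi, negMonomial_update hi]
    field_simp
  · simp [exchange, Function.update_of_ne hk]

variable [LinearOrder L] [IsStrictOrderedRing L]

/-- The vector of signs of a point with nonzero coordinates. -/
def signs (x : ι ⊕ κ → L) : F2Space ι κ := fun k => signBit (x k)

omit [DecidableEq ι] [DecidableEq κ] in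
theorem signBit_posMonomial (Z : Matrix ι (ι ⊕ κ) ℤ) (i : ι) {x : ι ⊕ κ → L} (hx : ∀ k, x k ≠ 0) :
    signBit (posMonomial Z i x) = posSum Z i (signs x) :=
  signBit_prod_pow _ hx _

omit [DecidableEq ι] [DecidableEq κ] in
theorem signBit_negMonomial (Z : Matrix ι (ι ⊕ κ) ℤ) (i : ι) {x : ι ⊕ κ → L} (hx : ∀ k, x k ≠ 0) :
    signBit (negMonomial Z i x) = negSum Z i (signs x) :=
  signBit_prod_pow _ hx _

theorem signs_exchange {Z : Matrix ι (ι ⊕ κ) ℤ} {i : ι} {y : ι ⊕ κ → L} (hy : ∀ k, y k ≠ 0)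
    (h0 : posMonomial Z i y + negMonomial Z i y ≠ 0) {s : ZMod 2}
    (hs : signBit (posMonomial Z i y + negMonomial Z i y) = s) :
    signs (exchange Z i y) = signs y + Pi.single (Sum.inl i) s := by
  have h2 : ∀ u w z : ZMod 2, u + w = z → u = w + z := by decide
  funext k
  by_cases hk : k = Sum.inl i
  · subst hk
    simp only [signs, exchange, Function.update_self, Pi.add_apply, Pi.single_eq_same]
    refine h2 _ _ _ ?_
    rw [← signBit_mul (div_ne_zero h0 (hy _)) (hy _), div_mul_cancel₀ _ (hy _), hs]
  · simp [signs, exchange, hk]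

/-- The signs of two adjacent clusters at a point correspond to each other under the crossing, up
to a flip. -/
theorem signs_exchange_equiv {Z : Matrix ι (ι ⊕ κ) ℤ} {i : ι} (hi : Z i (Sum.inl i) = 0)
    {y : ι ⊕ κ → L} (hy : ∀ k, y k ≠ 0) (h0 : posMonomial Z i y + negMonomial Z i y ≠ 0) :
    orbitSetoid Z (crossing Z i (signs y)) (signs (exchange Z i y)) := by
  rcases signBit_add_or (a := posMonomial Z i y) (b := negMonomial Z i y) with h | h
  · rw [signs_exchange hy h0 (h.trans (signBit_posMonomial Z i hy))]
    exact (orbitSetoid Z).refl' _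
  · rw [signs_exchange hy h0 (h.trans (signBit_negMonomial Z i hy)), ← flip_crossing _ hi]
    exact orbitSetoid_flip _ _ _

end Exchange

/-! ### Points of orthants with a prescribed dominant monomial -/

section Points

variable {ι κ : Type} [Fintype ι] [Fintype κ] [DecidableEq ι] [DecidableEq κ]

omit [Fintype ι] [Fintype κ] [DecidableEq ι] [DecidableEq κ] in
theorem signs_exists (ζ : F2Space ι κ) (c : ι ⊕ κ → ℝ) (hc : ∀ k, 0 < c k) :
    ∃ y : ι ⊕ κ → ℝ, (∀ k, y k ≠ 0) ∧ signs y = ζ ∧ ∀ k, |y k| = c k := by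
  refine ⟨fun k => if ζ k = 0 then c k else -c k, fun k => ?_, funext fun k => ?_, fun k => ?_⟩
  · dsimp only
    split_ifs <;> simp [(hc k).ne']
  · have h1 : ∀ z : ZMod 2, z ≠ 0 → 1 = z := by decide
    simp only [signs]
    split_ifs with h
    · rw [signBit_of_pos (hc k), h]
    · rw [signBit_of_neg (neg_lt_zero.2 (hc k)), h1 _ h]
  · dsimp only
    split_ifs <;> simp [abs_of_pos (hc k)]

omit [DecidableEq ι] [DecidableEq κ] in
theorem abs_prod_pow (y : ι ⊕ κ → ℝ) (n : ι ⊕ κ → ℕ) :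
    |∏ k, y k ^ n k| = ∏ k, |y k| ^ n k := by
  rw [Finset.abs_prod]; simp only [abs_pow]

omit [DecidableEq ι] [DecidableEq κ] in
/-- Every orthant contains a point at which the first monomial of the exchange relation
determines the sign of the sum of the two. -/
theorem exists_signBit_eq_posSum (Z : Matrix ι (ι ⊕ κ) ℤ) (i : ι) (ζ : F2Space ι κ) :
    ∃ y : ι ⊕ κ → ℝ, (∀ k, y k ≠ 0) ∧ signs y = ζ ∧ posMonomial Z i y + negMonomial Z i y ≠ 0 ∧
      signBit (posMonomial Z i y + negMonomial Z i y) = posSum Z i ζ := by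
  -- These absolute values make the first monomial at least `1` and the second at most `1` in
  -- absolute value.
  obtain ⟨y, hy, hs, hc⟩ := signs_exists ζ
    (fun k => if 0 < Z i k then 2 else if Z i k < 0 then 1 / 2 else 1)
    (fun k => by split_ifs <;> norm_num)
  refine ⟨y, hy, hs, ?_⟩
  have hp : |posMonomial Z i y| = ∏ k, (2 : ℝ) ^ (Z i k).toNat := by
    rw [posMonomial, abs_prod_pow]
    refine Finset.prod_congr rfl fun k _ => ?_
    rw [hc]
    split_ifs with h1 h2
    · rfl
    · simp [Int.toNat_of_nonpos h2.le]
    · simp [Int.toNat_of_nonpos (not_lt.1 h1)]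
  have hn : |negMonomial Z i y| = ∏ k, (1 / 2 : ℝ) ^ (-(Z i k)).toNat := by
    rw [negMonomial, abs_prod_pow]
    refine Finset.prod_congr rfl fun k _ => ?_
    rw [hc]
    split_ifs with h1 h2
    · simp [Int.toNat_of_nonpos (Int.neg_nonpos_of_nonneg h1.le)]
    · rfl
    · simp [Int.toNat_of_nonpos (Int.neg_nonpos_of_nonneg (not_lt.1 h2))]
  have hp1 : 1 ≤ |posMonomial Z i y| := by
    rw [hp, Finset.prod_pow_eq_pow_sum]; exact one_le_pow₀ (by norm_num)
  have hn1 : |negMonomial Z i y| ≤ 1 := by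
    rw [hn]
    exact Finset.prod_le_one (fun k _ => by positivity) fun k _ =>
      pow_le_one₀ (by norm_num) (by norm_num)
  rcases (hn1.trans hp1).lt_or_eq with h | h
  · refine ⟨fun h0 => ?_, ?_⟩
    · rw [add_eq_zero_iff_eq_neg.1 h0, abs_neg] at h
      exact lt_irrefl _ h
    · rw [signBit_add_of_abs_lt h, signBit_posMonomial Z i hy, hs]
  -- Equal absolute values must both be `1`, which forces the whole row to vanish; the sum is then
  -- `1 + 1`.
  · have hz : ∀ k, Z i k = 0 := by
      intro k
      have e1 : ∏ k, (2 : ℝ) ^ (Z i k).toNat = 1 := by rw [← hp]; linarith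
      have e2 : ∏ k, (1 / 2 : ℝ) ^ (-(Z i k)).toNat = 1 := by rw [← hn]; linarith
      rw [Finset.prod_pow_eq_pow_sum] at e1 e2
      have f1 : ∑ k, (Z i k).toNat = 0 := by
        by_contra h0
        exact (one_lt_pow₀ (by norm_num : (1 : ℝ) < 2) h0).ne' e1
      have f2 : ∑ k, (-(Z i k)).toNat = 0 := by
        by_contra h0
        exact (pow_lt_one₀ (by norm_num : (0 : ℝ) ≤ 1 / 2) (by norm_num) h0).ne e2
      have g1 := Finset.sum_eq_zero_iff.1 f1 k (Finset.mem_univ k)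
      have g2 := Finset.sum_eq_zero_iff.1 f2 k (Finset.mem_univ k)
      omega
    have e1 : posMonomial Z i y = 1 := by simp [posMonomial, hz]
    have e2 : negMonomial Z i y = 1 := by simp [negMonomial, hz]
    have e3 : posSum Z i ζ = 0 := by simp [posSum, hz]
    rw [e1, e2, e3]
    exact ⟨by norm_num, signBit_of_pos (by norm_num)⟩

omit [DecidableEq ι] [DecidableEq κ] in
/-- Every orthant contains a point at which the second monomial of the exchange relation
determines the sign of the sum of the two. -/
theorem exists_signBit_eq_negSum (Z : Matrix ι (ι ⊕ κ) ℤ) (i : ι) (ζ : F2Space ι κ) :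
    ∃ y : ι ⊕ κ → ℝ, (∀ k, y k ≠ 0) ∧ signs y = ζ ∧ posMonomial Z i y + negMonomial Z i y ≠ 0 ∧
      signBit (posMonomial Z i y + negMonomial Z i y) = negSum Z i ζ := by
  -- Negating the matrix interchanges the two monomials.
  have hp : ∀ y : ι ⊕ κ → ℝ, posMonomial (-Z) i y = negMonomial Z i y := fun y => rfl
  have hn : ∀ y : ι ⊕ κ → ℝ, negMonomial (-Z) i y = posMonomial Z i y := fun y => by
    simp [negMonomial, posMonomial]
  have h := exists_signBit_eq_posSum (-Z) i ζ
  simp only [hp, hn, add_comm (negMonomial Z i _)] at h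
  exact h

end Points

end

end ClusterManifold

namespace ClusterManifold

noncomputable section

/-! ### Ordered fields of germs at generic points -/

section GenericGerms

variable {σ : Type*} [Finite σ]

/-- The filter of neighbourhoods of a point within the complements of algebraic hypersurfaces. -/
def genericFilter (x : σ → ℝ) : Filter (σ → ℝ) where
  sets := {S | ∃ p : MvPolynomial σ ℝ, p ≠ 0 ∧
    ∀ᶠ y in nhds x, MvPolynomial.eval y p ≠ 0 → y ∈ S}
  univ_sets := ⟨1, one_ne_zero, by simp⟩
  sets_of_superset := fun ⟨p, hp, h⟩ hST => ⟨p, hp, h.mono fun _ hy h0 => hST (hy h0)⟩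
  inter_sets := by
    rintro S T ⟨p, hp, h⟩ ⟨q, hq, h'⟩
    refine ⟨p * q, mul_ne_zero hp hq, ?_⟩
    filter_upwards [h, h'] with y hy hy' h0
    rw [map_mul] at h0
    exact ⟨hy (left_ne_zero_of_mul h0), hy' (right_ne_zero_of_mul h0)⟩

omit [Finite σ] in
theorem genericFilter_le_nhds (x : σ → ℝ) : genericFilter x ≤ nhds x := fun _ hS =>
  ⟨1, one_ne_zero, Filter.mem_of_superset hS fun _ hy _ => hy⟩

omit [Finite σ] in
theorem eventually_eval_ne_zero (x : σ → ℝ) {p : MvPolynomial σ ℝ} (hp : p ≠ 0) :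
    ∀ᶠ y in genericFilter x, MvPolynomial.eval y p ≠ 0 :=
  ⟨p, hp, Filter.Eventually.of_forall fun _ h => h⟩

/-- A polynomial vanishing on a box around `x` is zero, since the sides of the box are infinite
sets. -/
instance genericFilter_neBot (x : σ → ℝ) : (genericFilter x).NeBot := by
  refine ⟨fun hbot => ?_⟩
  have he : ∅ ∈ genericFilter x := by rw [hbot]; trivial
  obtain ⟨p, hp, h⟩ := he
  have := Fintype.ofFinite σ
  obtain ⟨ε, hε, hb⟩ := Metric.eventually_nhds_iff.1 h
  refine hp (MvPolynomial.funext_set (fun j => Set.Ioo (x j - ε) (x j + ε))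
    (fun j => Set.Ioo_infinite (by linarith)) fun y hy => ?_)
  rw [map_zero]
  by_contra h0
  refine hb ((dist_pi_lt_iff hε).2 fun j => ?_) h0
  have := hy j trivial
  rw [Real.dist_eq, abs_lt]
  constructor <;> linarith [this.1, this.2]

/-- An ultrafilter of generic points close to `x`. -/
def genericUltrafilter (x : σ → ℝ) : Ultrafilter (σ → ℝ) := Ultrafilter.of (genericFilter x)

/-- The ordered field of germs of functions at generic points close to `x`. -/
abbrev GenericGerm (x : σ → ℝ) : Type _ :=
  Filter.Germ (genericUltrafilter x : Filter (σ → ℝ)) ℝ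

/-- The germ of a polynomial. -/
def polynomialGerm (x : σ → ℝ) : MvPolynomial σ ℝ →+* GenericGerm x :=
  (Filter.Germ.coeRingHom _).comp (RingHom.pi fun y => MvPolynomial.eval y)

/-- Injectivity allows the germ map to extend to rational functions, even those with a pole at `x`.
-/
theorem polynomialGerm_injective (x : σ → ℝ) : Function.Injective (polynomialGerm x) := by
  rw [injective_iff_map_eq_zero]
  intro p h
  by_contra hp
  have h1 : ∀ᶠ y in genericUltrafilter x, MvPolynomial.eval y p = 0 := Filter.Germ.coe_eq.1 h
  have h2 : ∀ᶠ y in genericUltrafilter x, MvPolynomial.eval y p ≠ 0 :=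
    Ultrafilter.of_le (genericFilter x) (eventually_eval_ne_zero x hp)
  obtain ⟨y, h3, h4⟩ := (h1.and h2).exists
  exact h4 h3

/-- The ultrafilter converges to `x`, so a nonzero value keeps its sign by continuity. -/
theorem signBit_polynomialGerm {x : σ → ℝ} {p : MvPolynomial σ ℝ}
    (hp : MvPolynomial.eval x p ≠ 0) :
    signBit (polynomialGerm x p) = signBit (MvPolynomial.eval x p) := by
  have hle : (genericUltrafilter x : Filter (σ → ℝ)) ≤ nhds x :=
    (Ultrafilter.of_le _).trans (genericFilter_le_nhds x)
  have hc := (MvPolynomial.continuous_eval p).tendsto x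
  rcases hp.lt_or_gt with h | h
  · rw [signBit_of_neg h, signBit_of_neg]
    exact Filter.Germ.coe_lt.2 (hle (hc.eventually (gt_mem_nhds h)))
  · rw [signBit_of_pos h, signBit_of_pos]
    exact Filter.Germ.coe_lt.2 (hle (hc.eventually (lt_mem_nhds h)))

end GenericGerms

/-! ### Extended clusters as coordinate systems -/

section Clusters

variable {ι κ : Type}

/-- An extended cluster is a coordinate system: a transcendence basis that generates the field of
rational functions. -/
structure IsCoordinateSystem (f : ι ⊕ κ → RatFun ι κ) : Prop where
  algebraicIndependent : AlgebraicIndependent ℝ f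
  adjoin_eq_top : IntermediateField.adjoin ℝ (Set.range f) = ⊤

/-- The rational functions, expressed through a coordinate system, have germs at generic points
close to a given point. -/
theorem IsCoordinateSystem.exists_ringHom [Finite ι] [Finite κ] {f : ι ⊕ κ → RatFun ι κ}
    (hf : IsCoordinateSystem f) (x : ι ⊕ κ → ℝ) :
    ∃ ψ : RatFun ι κ →+* GenericGerm x,
      ∀ p : MvPolynomial (ι ⊕ κ) ℝ, ψ (MvPolynomial.aeval f p) = polynomialGerm x p := by
  have hmem : ∀ a, a ∈ IntermediateField.adjoin ℝ (Set.range f) := by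
    rw [hf.adjoin_eq_top]; intro a; trivial
  let inc : RatFun ι κ →+* IntermediateField.adjoin ℝ (Set.range f) :=
    RingHom.codRestrict (RingHom.id _) _ hmem
  refine ⟨((IsFractionRing.lift (polynomialGerm_injective x)).comp
    hf.algebraicIndependent.aevalEquivField.symm.toRingEquiv.toRingHom).comp inc, fun p => ?_⟩
  have h : inc (MvPolynomial.aeval f p) =
      hf.algebraicIndependent.aevalEquivField (algebraMap _ _ p) := by
    ext
    rw [AlgebraicIndependent.aevalEquivField_algebraMap_apply_coe]
    rfl
  change IsFractionRing.lift (polynomialGerm_injective x)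
    (hf.algebraicIndependent.aevalEquivField.symm (inc (MvPolynomial.aeval f p))) = _
  rw [h, AlgEquiv.symm_apply_apply, IsFractionRing.lift_algebraMap]

theorem IsCoordinateSystem.ne_zero {f : ι ⊕ κ → RatFun ι κ} (hf : IsCoordinateSystem f)
    (j : ι ⊕ κ) : f j ≠ 0 := hf.algebraicIndependent.ne_zero j

theorem isCoordinateSystem_X : IsCoordinateSystem fun j : ι ⊕ κ =>
    algebraMap (MvPolynomial (ι ⊕ κ) ℝ) (RatFun ι κ) (MvPolynomial.X j) where
  algebraicIndependent :=
    (MvPolynomial.algebraicIndependent_X (ι ⊕ κ) ℝ).map'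
      (f := IsScalarTower.toAlgHom ℝ (MvPolynomial (ι ⊕ κ) ℝ) (RatFun ι κ))
      (IsFractionRing.injective _ _)
  adjoin_eq_top := by
    set F := IntermediateField.adjoin ℝ (Set.range fun j : ι ⊕ κ =>
      algebraMap (MvPolynomial (ι ⊕ κ) ℝ) (RatFun ι κ) (MvPolynomial.X j)) with hF
    have key : ∀ p : MvPolynomial (ι ⊕ κ) ℝ, algebraMap _ (RatFun ι κ) p ∈ F := by
      intro p
      induction p using MvPolynomial.induction_on with
      | C a => exact F.algebraMap_mem a
      | add p q hp hq => rw [map_add]; exact add_mem hp hq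
      | mul_X p j hp =>
        rw [map_mul]
        exact mul_mem hp (IntermediateField.subset_adjoin _ _ ⟨j, rfl⟩)
    refine eq_top_iff.2 fun a _ => ?_
    obtain ⟨p, q, _, rfl⟩ := IsFractionRing.div_surjective (A := MvPolynomial (ι ⊕ κ) ℝ) a
    exact div_mem (key p) (key q)

variable [Fintype ι] [Fintype κ]

/-- By algebraic independence it suffices that a polynomial is nonzero, and its value at `(1, …, 1)`
is `2`. -/
theorem posMonomial_add_negMonomial_ne_zero {f : ι ⊕ κ → RatFun ι κ} (hf : IsCoordinateSystem f)
    (Z : Matrix ι (ι ⊕ κ) ℤ) (i : ι) : posMonomial Z i f + negMonomial Z i f ≠ 0 := by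
  have h : posMonomial Z i f + negMonomial Z i f = MvPolynomial.aeval f
      (posMonomial (R := MvPolynomial (ι ⊕ κ) ℝ) Z i MvPolynomial.X +
        negMonomial (R := MvPolynomial (ι ⊕ κ) ℝ) Z i MvPolynomial.X) := by
    rw [map_add, map_posMonomial, map_negMonomial]
    simp only [MvPolynomial.aeval_X]
  rw [h]
  intro h0
  have h1 := (algebraicIndependent_iff.1 hf.algebraicIndependent) _ h0
  have h2 := congrArg (MvPolynomial.eval fun _ => (1 : ℝ)) h1
  rw [map_add, map_posMonomial, map_negMonomial] at h2
  norm_num [posMonomial, negMonomial] at h2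

variable [DecidableEq ι] [DecidableEq κ]

/-- The exchange is an involution, so the new cluster still generates the field. A generating family
no larger than the transcendence degree is algebraically independent. -/
theorem IsCoordinateSystem.exchange {f : ι ⊕ κ → RatFun ι κ} (hf : IsCoordinateSystem f)
    {Z : Matrix ι (ι ⊕ κ) ℤ} {i : ι} (hi : Z i (Sum.inl i) = 0) :
    IsCoordinateSystem (exchange Z i f) := by
  have htop : IntermediateField.adjoin ℝ (Set.range (ClusterManifold.exchange Z i f)) = ⊤ := by
    rw [eq_top_iff, ← hf.adjoin_eq_top, IntermediateField.adjoin_le_iff]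
    set F := IntermediateField.adjoin ℝ (Set.range (ClusterManifold.exchange Z i f))
    have hF : ∀ j, ClusterManifold.exchange Z i f j ∈ F := fun j =>
      IntermediateField.subset_adjoin _ _ ⟨j, rfl⟩
    rintro _ ⟨j, rfl⟩
    rw [← exchange_exchange hi (hf.ne_zero _) (posMonomial_add_negMonomial_ne_zero hf Z i)]
    by_cases hj : j = Sum.inl i
    · subst hj
      rw [ClusterManifold.exchange, Function.update_self]
      exact div_mem (add_mem (prod_mem fun k _ => pow_mem (hF k) _)
        (prod_mem fun k _ => pow_mem (hF k) _)) (hF _)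
    · rw [ClusterManifold.exchange, Function.update_of_ne hj]
      exact hF j
  refine ⟨?_, htop⟩
  have halg : Algebra.IsAlgebraic
      (Algebra.adjoin ℝ (Set.range (ClusterManifold.exchange Z i f))) (RatFun ι κ) := by
    rw [← IntermediateField.isAlgebraic_adjoin_iff_top, htop]
    infer_instance
  exact (Algebra.IsAlgebraic.isTranscendenceBasis_of_le_trdeg_of_finite ℝ _
    hf.algebraicIndependent.cardinalMk_le_trdeg).1

theorem seedAlong_cons_f (Z : Matrix ι (ι ⊕ κ) ℤ) (i : ι) (w : List ι) :
    (seedAlong Z (i :: w)).f = exchange (seedAlong Z w).Z i (seedAlong Z w).f := rfl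

variable {d : ι → ℕ} {Z : Matrix ι (ι ⊕ κ) ℤ}

theorem isCoordinateSystem_seedAlong (hd : ∀ i, 0 < d i) (hZ : IsSkewSymmetrizable d Z) :
    ∀ w : List ι, IsCoordinateSystem (seedAlong Z w).f
  | [] => isCoordinateSystem_X
  | i :: w => (isCoordinateSystem_seedAlong hd hZ w).exchange
      ((hZ.seedAlong hd w).diag_eq_zero hd i)

theorem seedAlong_f_inr (Z : Matrix ι (ι ⊕ κ) ℤ) (j : κ) :
    ∀ w : List ι, (seedAlong Z w).f (Sum.inr j) = (seedAlong Z []).f (Sum.inr j)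
  | [] => rfl
  | i :: w => by
    rw [seedAlong_cons_f, exchange, Function.update_of_ne (by simp), seedAlong_f_inr Z j w]

theorem map_exchange {K L : Type*} [Field K] [Field L] (φ : K →+* L) (Z : Matrix ι (ι ⊕ κ) ℤ)
    (i : ι) (f : ι ⊕ κ → K) : (fun k => φ (exchange Z i f k)) = exchange Z i fun k => φ (f k) := by
  funext k
  by_cases hk : k = Sum.inl i
  · subst hk
    simp [exchange, map_posMonomial, map_negMonomial]
  · simp [exchange, Function.update_of_ne hk]

/-- For any ordering of the field of rational functions, the signs of all extended clusters
are transported to the same orbit at the root. -/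
theorem orbitSetoid_transport_signs (hd : ∀ i, 0 < d i) (hZ : IsSkewSymmetrizable d Z)
    {L : Type*} [Field L] [LinearOrder L] [IsStrictOrderedRing L] (ψ : RatFun ι κ →+* L) :
    ∀ w : List ι, orbitSetoid Z (transport Z w (signs fun k => ψ ((seedAlong Z w).f k)))
      (signs fun k => ψ ((seedAlong Z []).f k))
  | [] => (orbitSetoid Z).refl' _
  | i :: w => by
    refine (orbitSetoid Z).trans' ?_ (orbitSetoid_transport_signs hd hZ ψ w)
    have hi := (hZ.seedAlong hd w).diag_eq_zero hd i
    have hf := isCoordinateSystem_seedAlong hd hZ w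
    have hf' := isCoordinateSystem_seedAlong hd hZ (i :: w)
    have hx := exchange_exchange hi (hf.ne_zero _) (posMonomial_add_negMonomial_ne_zero hf _ i)
    rw [← seedAlong_cons_f] at hx
    -- The cluster nearer the root is written as the exchange of the farther one, the direction in
    -- which `crossing` acts.
    rw [transport, orbitSetoid_transport_iff hd hZ, ← hx, map_exchange]
    refine signs_exchange_equiv hi (fun k => (map_ne_zero ψ).2 (hf'.ne_zero k)) ?_
    have h0 := posMonomial_add_negMonomial_ne_zero hf' (seedAlong Z w).Z i
    rw [← map_posMonomial, ← map_negMonomial, ← map_add]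
    exact (map_ne_zero ψ).2 h0

end Clusters

/-! ### Invariance of sign orbits under gluing -/

section Gluing

variable {ι κ : Type} [Fintype ι] [Fintype κ] [DecidableEq ι] [DecidableEq κ]
  {d : ι → ℕ} {Z : Matrix ι (ι ⊕ κ) ℤ}

omit [DecidableEq ι] [DecidableEq κ] in
-- Numerator and denominator are both nonzero at `x`, so their germs have the signs of their values,
-- and so has the quotient.
theorem IsRegularWithValue.signBit_eq {f : ι ⊕ κ → RatFun ι κ} {x : ι ⊕ κ → ℝ} {g : RatFun ι κ}
    {a : ℝ} (h : IsRegularWithValue f x g a) (ha : a ≠ 0) {ψ : RatFun ι κ →+* GenericGerm x}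
    (hψ : ∀ p : MvPolynomial (ι ⊕ κ) ℝ, ψ (MvPolynomial.aeval f p) = polynomialGerm x p) :
    signBit (ψ g) = signBit a := by
  obtain ⟨p, q, hq, hg, rfl⟩ := h
  have hp : MvPolynomial.eval x p ≠ 0 := fun h0 => ha (by rw [h0, zero_div])
  have h1 : ψ g * polynomialGerm x q = polynomialGerm x p := by rw [← hψ, ← hψ, ← hg, map_mul]
  have inj := polynomialGerm_injective x
  have hq' : polynomialGerm x q ≠ 0 := (map_ne_zero_iff _ inj).2 (by rintro rfl; simp at hq)
  have hp' : polynomialGerm x p ≠ 0 := (map_ne_zero_iff _ inj).2 (by rintro rfl; simp at hp)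
  have hg' : ψ g ≠ 0 := by rintro h0; rw [h0, zero_mul] at h1; exact hp' h1.symm
  have e1 := signBit_mul hg' hq'
  have e2 := signBit_mul ha hq
  rw [h1, signBit_polynomialGerm hp, signBit_polynomialGerm hq] at e1
  rw [div_mul_cancel₀ _ hq, e1] at e2
  exact add_right_cancel e2

omit [Fintype ι] [Fintype κ] [DecidableEq ι] [DecidableEq κ] in
theorem IsRegularWithValue.eq_of_coordinate {f : ι ⊕ κ → RatFun ι κ} (hf : IsCoordinateSystem f)
    {x : ι ⊕ κ → ℝ} {j : ι ⊕ κ} {a : ℝ} (h : IsRegularWithValue f x (f j) a) : a = x j := by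
  obtain ⟨p, q, hq, hg, rfl⟩ := h
  have h0 : MvPolynomial.X j * q - p = 0 := by
    apply algebraicIndependent_iff.1 hf.algebraicIndependent
    rw [map_sub, map_mul, MvPolynomial.aeval_X, hg, sub_self]
  have h1 := congrArg (MvPolynomial.eval x) (sub_eq_zero.1 h0)
  rw [map_mul, MvPolynomial.eval_X] at h1
  rw [← h1, mul_div_cancel_right₀ _ hq]

omit [Fintype ι] [Fintype κ] [DecidableEq ι] [DecidableEq κ] in
theorem isRegularWithValue_coordinate (f : ι ⊕ κ → RatFun ι κ) (x : ι ⊕ κ → ℝ) (j : ι ⊕ κ) :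
    IsRegularWithValue f x (f j) (x j) :=
  ⟨MvPolynomial.X j, 1, by simp, by simp, by simp⟩

/-- Glued points have the same tropic coordinates. -/
theorem Glued.inr_eq (hd : ∀ i, 0 < d i) (hZ : IsSkewSymmetrizable d Z) {P Q : ChartPoint ι κ}
    (h : Glued Z P Q) (j : κ) : Q.2.1 (Sum.inr j) = P.2.1 (Sum.inr j) := by
  have hf : IsCoordinateSystem (seedAt Z P.1).f := isCoordinateSystem_seedAlong hd hZ P.1.1
  have h1 := h.1 (Sum.inr j)
  have h2 : (seedAt Z Q.1).f (Sum.inr j) = (seedAt Z P.1).f (Sum.inr j) :=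
    (seedAlong_f_inr Z j _).trans (seedAlong_f_inr Z j _).symm
  rw [h2] at h1
  exact h1.eq_of_coordinate hf

/-- Glued points with nonzero coordinates have their signs transported to the same orbit. -/
theorem Glued.orbitSetoid_transport (hd : ∀ i, 0 < d i) (hZ : IsSkewSymmetrizable d Z)
    {P Q : ChartPoint ι κ} (h : Glued Z P Q) (hP : ∀ k, P.2.1 k ≠ 0) (hQ : ∀ k, Q.2.1 k ≠ 0) :
    orbitSetoid Z (transport Z P.1.1 (signs P.2.1)) (transport Z Q.1.1 (signs Q.2.1)) := by
  -- One ordering, taken near `P`, reads off both sign vectors: the coordinates at `Q` are values of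
  -- functions regular at `P`.
  obtain ⟨ψ, hψ⟩ := (isCoordinateSystem_seedAlong hd hZ P.1.1).exists_ringHom P.2.1
  have e1 : signs P.2.1 = signs fun k => ψ ((seedAlong Z P.1.1).f k) := funext fun k =>
    ((isRegularWithValue_coordinate _ _ k).signBit_eq (hP k) hψ).symm
  have e2 : signs Q.2.1 = signs fun k => ψ ((seedAlong Z Q.1.1).f k) := funext fun k =>
    ((h.1 k).signBit_eq (hQ k) hψ).symm
  rw [e1, e2]
  exact (orbitSetoid Z).trans' (orbitSetoid_transport_signs hd hZ ψ _)
    ((orbitSetoid Z).symm' (orbitSetoid_transport_signs hd hZ ψ _))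

end Gluing

end

end ClusterManifold

namespace ClusterManifold

noncomputable section

/-! ### Orthants -/

section Orthants

variable {ι κ : Type}

/-- The open orthant with prescribed signs. -/
def orthant (ξ : F2Space ι κ) : Set (ι ⊕ κ → ℝ) :=
  Set.univ.pi fun k => if ξ k = 0 then Set.Ioi 0 else Set.Iio 0

theorem mem_orthant_iff {ξ : F2Space ι κ} {x : ι ⊕ κ → ℝ} :
    x ∈ orthant ξ ↔ (∀ k, x k ≠ 0) ∧ signs x = ξ := by
  have h1 : ∀ z : ZMod 2, z ≠ 0 ↔ 1 = z := by decide
  have key : ∀ k, x k ∈ (if ξ k = 0 then Set.Ioi 0 else Set.Iio (0 : ℝ)) ↔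
      x k ≠ 0 ∧ signBit (x k) = ξ k := by
    intro k
    rcases lt_trichotomy (x k) 0 with h | h | h
    · by_cases h0 : ξ k = 0
      · simp [h0, signBit_of_neg h, h.le]
      · simp [h0, signBit_of_neg h, h, h.ne, (h1 _).1 h0]
    · split_ifs <;> simp [h]
    · by_cases h0 : ξ k = 0
      · simp [h0, signBit_of_pos h, h, h.ne']
      · simp [h0, signBit_of_pos h, h.le, Ne.symm h0]
  simp only [orthant, Set.mem_univ_pi, key, signs, funext_iff, forall_and]

theorem isOpen_orthant [Finite ι] [Finite κ] (ξ : F2Space ι κ) : IsOpen (orthant ξ) :=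
  isOpen_set_pi Set.finite_univ fun k _ => by split_ifs; exacts [isOpen_Ioi, isOpen_Iio]

theorem isPreconnected_orthant (ξ : F2Space ι κ) : IsPreconnected (orthant ξ) :=
  (convex_pi fun k _ => by split_ifs; exacts [convex_Ioi 0, convex_Iio 0]).isPreconnected

end Orthants

/-! ### Connected components and orbits -/

section Components

variable {ι κ : Type} [Fintype ι] [Fintype κ] [DecidableEq ι] [DecidableEq κ]
  {d : ι → ℕ} {Z : Matrix ι (ι ⊕ κ) ℤ}

/-- The point of the regular part given by its nonzero coordinates in a chart. -/
def toRegularPart (Z : Matrix ι (ι ⊕ κ) ℤ) (v : TreeVertex ι) (x : {x : ι ⊕ κ → ℝ // ∀ k, x k ≠ 0}) :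
    regularPart Z :=
  ⟨Quot.mk _ ⟨v, ⟨x.1, fun i => x.2 (Sum.inl i)⟩⟩, v, ⟨x.1, fun i => x.2 (Sum.inl i)⟩,
    fun j => x.2 (Sum.inr j), rfl⟩

theorem continuous_toRegularPart (Z : Matrix ι (ι ⊕ κ) ℤ) (v : TreeVertex ι) :
    Continuous (toRegularPart Z v) := by
  refine Continuous.subtype_mk (continuous_quot_mk.comp ((continuous_sigmaMk (i := v)).comp ?_)) _
  exact Continuous.subtype_mk continuous_subtype_val _

theorem exists_eq_toRegularPart (P : regularPart Z) : ∃ v x, P = toRegularPart Z v x := by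
  obtain ⟨_, v, x, hx, rfl⟩ := P
  exact ⟨v, ⟨x.1, fun k => k.rec x.2 hx⟩, rfl⟩

theorem isRegularWithValue_exchange {f : ι ⊕ κ → RatFun ι κ} {y : ι ⊕ κ → ℝ} {i : ι}
    (hf : f (Sum.inl i) ≠ 0) (hy : y (Sum.inl i) ≠ 0) (Z : Matrix ι (ι ⊕ κ) ℤ) (j : ι ⊕ κ) :
    IsRegularWithValue f y (exchange Z i f j) (exchange Z i y j) := by
  by_cases hj : j = Sum.inl i
  · subst hj
    refine ⟨posMonomial (R := MvPolynomial (ι ⊕ κ) ℝ) Z i MvPolynomial.X +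
        negMonomial (R := MvPolynomial (ι ⊕ κ) ℝ) Z i MvPolynomial.X,
      MvPolynomial.X (Sum.inl i), by simpa using hy, ?_, ?_⟩
    · rw [map_add, map_posMonomial, map_negMonomial]
      simp only [MvPolynomial.aeval_X, exchange, Function.update_self]
      exact div_mul_cancel₀ _ hf
    · rw [map_add, map_posMonomial, map_negMonomial]
      simp only [MvPolynomial.eval_X, exchange, Function.update_self]
  · simp only [exchange, Function.update_of_ne hj]
    exact isRegularWithValue_coordinate f y j

/-- A point of a chart is glued to the point of the adjacent chart, closer to the root, provided
by the exchange relation. -/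
theorem toRegularPart_cons (hd : ∀ i, 0 < d i) (hZ : IsSkewSymmetrizable d Z) {i : ι} {w : List ι}
    (hv : (i :: w).IsChain (· ≠ ·)) (hw : w.IsChain (· ≠ ·))
    (y x : {x : ι ⊕ κ → ℝ // ∀ k, x k ≠ 0}) (hx : x.1 = exchange (seedAlong Z w).Z i y.1)
    (h0 : posMonomial (seedAlong Z w).Z i y.1 + negMonomial (seedAlong Z w).Z i y.1 ≠ 0) :
    toRegularPart Z ⟨i :: w, hv⟩ y = toRegularPart Z ⟨w, hw⟩ x := by
  have hi := (hZ.seedAlong hd w).diag_eq_zero hd i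
  have hf := isCoordinateSystem_seedAlong hd hZ w
  have hf' := isCoordinateSystem_seedAlong hd hZ (i :: w)
  refine Subtype.ext (Quot.sound ⟨fun j => ?_, fun j => ?_⟩)
  · have e := exchange_exchange hi (hf.ne_zero _) (posMonomial_add_negMonomial_ne_zero hf _ i)
    change IsRegularWithValue (seedAlong Z (i :: w)).f y.1 ((seedAlong Z w).f j) (x.1 j)
    rw [← e, hx]
    exact isRegularWithValue_exchange (hf'.ne_zero _) (y.2 _) _ j
  · have e := exchange_exchange hi (y.2 _) h0
    change IsRegularWithValue (seedAlong Z w).f x.1 ((seedAlong Z (i :: w)).f j) (y.1 j)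
    rw [← e, ← hx]
    exact isRegularWithValue_exchange (hf.ne_zero _) (x.2 _) _ j

/-- The connected component that contains a given orthant of a chart. -/
def orthantComponent (Z : Matrix ι (ι ⊕ κ) ℤ) (v : TreeVertex ι) (ξ : F2Space ι κ) :
    ConnectedComponents (regularPart Z) :=
  ConnectedComponents.mk (toRegularPart Z v
    ⟨(signs_exists ξ 1 fun _ => one_pos).choose, (signs_exists ξ 1 fun _ => one_pos).choose_spec.1⟩)

/-- The image of a convex orthant is connected, so the chosen representative does not matter. -/
theorem mk_toRegularPart (Z : Matrix ι (ι ⊕ κ) ℤ) (v : TreeVertex ι)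
    (x : {x : ι ⊕ κ → ℝ // ∀ k, x k ≠ 0}) {ξ : F2Space ι κ} (hx : signs x.1 = ξ) :
    ConnectedComponents.mk (toRegularPart Z v x) = orthantComponent Z v ξ := by
  have := isPreconnected_iff_preconnectedSpace.1 (isPreconnected_orthant ξ)
  let g : orthant ξ → regularPart Z :=
    fun y => toRegularPart Z v ⟨y.1, (mem_orthant_iff.1 y.2).1⟩
  have hg : Continuous g :=
    (continuous_toRegularPart Z v).comp (Continuous.subtype_mk continuous_subtype_val _)
  rw [orthantComponent]
  refine ConnectedComponents.coe_eq_coe'.2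
    ((isPreconnected_range hg).subset_connectedComponent ?_ ?_)
  · exact ⟨⟨_, mem_orthant_iff.2 ⟨(signs_exists ξ 1 fun _ => one_pos).choose_spec.1,
      (signs_exists ξ 1 fun _ => one_pos).choose_spec.2.1⟩⟩, rfl⟩
  · exact ⟨⟨x.1, mem_orthant_iff.2 ⟨x.2, hx⟩⟩, rfl⟩

/-- A single glued point links the two orthants. -/
theorem orthantComponent_cons_of_signBit (hd : ∀ i, 0 < d i) (hZ : IsSkewSymmetrizable d Z)
    {i : ι} {w : List ι} (hv : (i :: w).IsChain (· ≠ ·)) (hw : w.IsChain (· ≠ ·))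
    {y : ι ⊕ κ → ℝ} (hy : ∀ k, y k ≠ 0) {s : ZMod 2}
    (h0 : posMonomial (seedAlong Z w).Z i y + negMonomial (seedAlong Z w).Z i y ≠ 0)
    (hs : signBit (posMonomial (seedAlong Z w).Z i y + negMonomial (seedAlong Z w).Z i y) = s) :
    orthantComponent Z ⟨i :: w, hv⟩ (signs y) =
      orthantComponent Z ⟨w, hw⟩ (signs y + Pi.single (Sum.inl i) s) := by
  have hx : ∀ k, exchange (seedAlong Z w).Z i y k ≠ 0 := by
    intro k
    by_cases hk : k = Sum.inl i
    · subst hk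
      simpa [exchange] using ⟨h0, hy _⟩
    · simpa [exchange, Function.update_of_ne hk] using hy k
  rw [← mk_toRegularPart Z ⟨i :: w, hv⟩ ⟨y, hy⟩ rfl,
    ← mk_toRegularPart Z ⟨w, hw⟩ ⟨_, hx⟩ (signs_exchange hy h0 hs),
    toRegularPart_cons hd hZ hv hw ⟨y, hy⟩ ⟨_, hx⟩ rfl h0]

theorem orthantComponent_cons (hd : ∀ i, 0 < d i) (hZ : IsSkewSymmetrizable d Z)
    {i : ι} {w : List ι} (hv : (i :: w).IsChain (· ≠ ·)) (hw : w.IsChain (· ≠ ·))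
    (ζ : F2Space ι κ) : orthantComponent Z ⟨i :: w, hv⟩ ζ =
      orthantComponent Z ⟨w, hw⟩ (crossing (seedAlong Z w).Z i ζ) := by
  obtain ⟨y, hy, rfl, h0, hs⟩ := exists_signBit_eq_posSum (seedAlong Z w).Z i ζ
  exact orthantComponent_cons_of_signBit hd hZ hv hw hy h0 hs

theorem orthantComponent_cons_flip (hd : ∀ i, 0 < d i) (hZ : IsSkewSymmetrizable d Z)
    {i : ι} {w : List ι} (hv : (i :: w).IsChain (· ≠ ·)) (hw : w.IsChain (· ≠ ·))
    (ζ : F2Space ι κ) : orthantComponent Z ⟨i :: w, hv⟩ ζ =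
      orthantComponent Z ⟨w, hw⟩
        (flip (seedAlong Z w).Z i (crossing (seedAlong Z w).Z i ζ)) := by
  rw [flip_crossing ζ ((hZ.seedAlong hd w).diag_eq_zero hd i)]
  obtain ⟨y, hy, rfl, h0, hs⟩ := exists_signBit_eq_negSum (seedAlong Z w).Z i ζ
  exact orthantComponent_cons_of_signBit hd hZ hv hw hy h0 hs

/-- The root of the tree. -/
def rootVertex (ι : Type) : TreeVertex ι := ⟨[], List.isChain_nil⟩

theorem orthantComponent_transport (hd : ∀ i, 0 < d i) (hZ : IsSkewSymmetrizable d Z) :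
    ∀ (w : List ι) (hw : w.IsChain (· ≠ ·)) (ζ : F2Space ι κ),
      orthantComponent Z ⟨w, hw⟩ ζ = orthantComponent Z (rootVertex ι) (transport Z w ζ)
  | [], _, _ => rfl
  | i :: w, hw, ζ => by
    rw [orthantComponent_cons hd hZ hw hw.of_cons,
      orthantComponent_transport hd hZ w hw.of_cons]
    rfl

/-- One orthant of the chart next to the root in direction `i` meets both orthants. -/
theorem orthantComponent_flip (hd : ∀ i, 0 < d i) (hZ : IsSkewSymmetrizable d Z) (i : ι)
    (ξ : F2Space ι κ) :
    orthantComponent Z (rootVertex ι) ξ = orthantComponent Z (rootVertex ι) (flip Z i ξ) := by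
  have hi := hZ.diag_eq_zero hd i
  have hv : [i].IsChain (· ≠ ·) := List.isChain_singleton i
  have h1 := orthantComponent_cons hd hZ hv List.isChain_nil (crossing Z i ξ)
  have h2 := orthantComponent_cons_flip hd hZ hv List.isChain_nil (crossing Z i ξ)
  have h3 := h1.symm.trans h2
  have e : (seedAlong Z ([] : List ι)).Z = Z := rfl
  rwa [e, crossing_crossing ξ hi] at h3

open Classical in
/-- The orbit of signs, transported to the root, of a point of a chart with nonzero coordinates. -/
def chartOrbit (Z : Matrix ι (ι ⊕ κ) ℤ) (P : ChartPoint ι κ) : Option (Quotient (orbitSetoid Z)) :=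
  if ∀ k, P.2.1 k ≠ 0 then some ⟦transport Z P.1.1 (signs P.2.1)⟧ else none

theorem chartOrbit_eq_of_glued (hd : ∀ i, 0 < d i) (hZ : IsSkewSymmetrizable d Z)
    {P Q : ChartPoint ι κ} (h : Glued Z P Q) : chartOrbit Z P = chartOrbit Z Q := by
  -- Cluster coordinates are nonzero in every chart, and tropic coordinates agree at glued points.
  have hiff : (∀ k, P.2.1 k ≠ 0) ↔ ∀ k, Q.2.1 k ≠ 0 := by
    simp only [Sum.forall, h.inr_eq hd hZ]
    exact and_congr_left fun _ => iff_of_true P.2.2 Q.2.2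
  by_cases hP : ∀ k, P.2.1 k ≠ 0
  · rw [chartOrbit, chartOrbit, if_pos hP, if_pos (hiff.1 hP),
      Quotient.sound (h.orbitSetoid_transport hd hZ hP (hiff.1 hP))]
  · rw [chartOrbit, chartOrbit, if_neg hP, if_neg (mt hiff.2 hP)]

/-- The orbit of signs at the root, as a function on the cluster manifold. -/
def manifoldOrbit (hd : ∀ i, 0 < d i) (hZ : IsSkewSymmetrizable d Z) :
    Manifold Z → Option (Quotient (orbitSetoid Z)) :=
  Quot.lift (chartOrbit Z) fun _ _ => chartOrbit_eq_of_glued hd hZ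

theorem manifoldOrbit_toRegularPart (hd : ∀ i, 0 < d i) (hZ : IsSkewSymmetrizable d Z)
    (v : TreeVertex ι) (x : {x : ι ⊕ κ → ℝ // ∀ k, x k ≠ 0}) :
    manifoldOrbit hd hZ (toRegularPart Z v x) = some ⟦transport Z v.1 (signs x.1)⟧ :=
  if_pos x.2

/-- The trace on each chart is a union of open orthants. -/
theorem isOpen_manifoldOrbit (hd : ∀ i, 0 < d i) (hZ : IsSkewSymmetrizable d Z)
    (c : Quotient (orbitSetoid Z)) : IsOpen {P | manifoldOrbit hd hZ P = some c} := by
  refine isOpen_coinduced.2 (isOpen_sigma_iff.2 fun v => ?_)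
  change IsOpen {x : Chart ι κ | chartOrbit Z ⟨v, x⟩ = some c}
  have h : {x : Chart ι κ | chartOrbit Z ⟨v, x⟩ = some c} =
      ⋃ (ξ : F2Space ι κ) (_ : ⟦transport Z v.1 ξ⟧ = c), {x : Chart ι κ | x.1 ∈ orthant ξ} := by
    ext x
    simp only [mem_orthant_iff, Set.mem_iUnion, exists_prop]
    change chartOrbit Z ⟨v, x⟩ = some c ↔ ∃ ξ, ⟦transport Z v.1 ξ⟧ = c ∧
      (∀ k, x.1 k ≠ 0) ∧ signs x.1 = ξ
    unfold chartOrbit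
    constructor
    · intro h
      split_ifs at h with hx
      exact ⟨_, Option.some.inj h, hx, rfl⟩
    · rintro ⟨_, h, hx, rfl⟩
      rw [if_pos hx, h]
  rw [h]
  exact isOpen_iUnion fun ξ => isOpen_iUnion fun _ =>
    (isOpen_orthant ξ).preimage continuous_subtype_val

theorem isLocallyConstant_manifoldOrbit (hd : ∀ i, 0 < d i) (hZ : IsSkewSymmetrizable d Z) :
    IsLocallyConstant fun P : regularPart Z => manifoldOrbit hd hZ P.1 := by
  rw [IsLocallyConstant.iff_exists_open]
  intro P
  obtain ⟨v, x, rfl⟩ := exists_eq_toRegularPart P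
  refine ⟨_, (isOpen_manifoldOrbit hd hZ ⟦transport Z v.1 (signs x.1)⟧).preimage
    continuous_subtype_val, manifoldOrbit_toRegularPart hd hZ v x, fun Q hQ => ?_⟩
  exact hQ.trans (manifoldOrbit_toRegularPart hd hZ v x).symm

/-- The components of the regular part correspond to the orbits of signs at the root. -/
def orbitComponent (hd : ∀ i, 0 < d i) (hZ : IsSkewSymmetrizable d Z) :
    Quotient (orbitSetoid Z) → ConnectedComponents (regularPart Z) :=
  Quotient.lift (orthantComponent Z (rootVertex ι)) fun _ _ h =>
    orbitSetoid_le (r := Setoid.ker (orthantComponent Z (rootVertex ι)))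
      (fun i ξ => orthantComponent_flip hd hZ i ξ) h

/-- Injectivity holds because a locally constant function is constant on components; surjectivity,
because every orthant is transported to the root. -/
theorem orbitComponent_bijective (hd : ∀ i, 0 < d i) (hZ : IsSkewSymmetrizable d Z) :
    Function.Bijective (orbitComponent hd hZ) := by
  constructor
  · intro a b
    induction a using Quotient.inductionOn with | _ ξ =>
    induction b using Quotient.inductionOn with | _ ζ =>
    intro h
    obtain ⟨x, hx, rfl, -⟩ := signs_exists ξ 1 fun _ => one_pos
    obtain ⟨y, hy, rfl, -⟩ := signs_exists ζ 1 fun _ => one_pos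
    change orthantComponent Z _ _ = orthantComponent Z _ _ at h
    rw [← mk_toRegularPart Z _ ⟨x, hx⟩ rfl, ← mk_toRegularPart Z _ ⟨y, hy⟩ rfl] at h
    have h1 := (isLocallyConstant_manifoldOrbit hd hZ).apply_eq_of_isPreconnected
      isPreconnected_connectedComponent (ConnectedComponents.coe_eq_coe'.1 h)
      mem_connectedComponent
    simp only [manifoldOrbit_toRegularPart] at h1
    exact Option.some.inj h1
  · intro c
    obtain ⟨P, rfl⟩ := ConnectedComponents.surjective_coe c
    obtain ⟨v, x, rfl⟩ := exists_eq_toRegularPart P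
    refine ⟨⟦transport Z v.1 (signs x.1)⟧, ?_⟩
    rw [mk_toRegularPart Z v x rfl]
    exact (orthantComponent_transport hd hZ v.1 v.2 _).symm

theorem finite_connectedComponents (hd : ∀ i, 0 < d i) (hZ : IsSkewSymmetrizable d Z) :
    Finite (ConnectedComponents (regularPart Z)) :=
  Finite.of_surjective _ (orbitComponent_bijective hd hZ).2

/-- The number of components equals the number of orbits of the group of transvections. -/
theorem numComponents_eq_numOrbits (hd : ∀ i, 0 < d i) (hZ : IsSkewSymmetrizable d Z)
    (v : TreeVertex ι) {η : LinearMap.BilinForm (ZMod 2) (F2Space ι κ)}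
    (hη : ∀ i j, η (e j) (e (Sum.inl i)) = ((seedAt Z v).Z i j : ZMod 2)) :
    numComponents Z = numOrbits η := by
  rw [numOrbits_eq_card_quotient hη fun i => (hZ.seedAlong hd v.1).diag_eq_zero hd i]
  exact (Nat.card_congr (Equiv.ofBijective _ (orbitComponent_bijective hd hZ))).symm.trans
    (card_quotient_orbitSetoid_seedAlong hd hZ v.1).symm

omit [Fintype ι] [Fintype κ] [DecidableEq ι] [DecidableEq κ] in
-- Skew-symmetry turns the left side into `-d_i z_ij`, and both the sign and the odd factor `d_i`
-- disappear modulo 2.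
theorem IsSquareExtension.cast_eq {Z' : Matrix (ι ⊕ κ) (ι ⊕ κ) ℤ} (h : IsSquareExtension d Z Z')
    (hodd : ∀ i, Odd (d i)) (i : ι) (j : ι ⊕ κ) :
    (((dHat d j : ℤ) * Z' j (Sum.inl i) : ℤ) : ZMod 2) = (Z i j : ZMod 2) := by
  have hneg : ∀ z : ZMod 2, -z = z := by decide
  have h1 : ((d i : ℤ) : ZMod 2) = 1 := by
    rw [Int.cast_natCast]
    exact (ZMod.natCast_eq_one_iff_odd).2 (hodd i)
  rw [h.1 j (Sum.inl i), h.2 i j, dHat, Sum.elim_inl, Int.cast_neg, Int.cast_mul, h1, one_mul,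
    hneg]

end Components

end

end ClusterManifold

theorem theorem2p10 (m k : ℕ) (d : Fin m → ℕ) (hd : ∀ i, 0 < d i)
    (Z : Matrix (Fin m) (Fin m ⊕ Fin k) ℤ) (hZ : ClusterManifold.IsSkewSymmetrizable d Z)
    (v : ClusterManifold.TreeVertex (Fin m)) :
    (∀ η : LinearMap.BilinForm (ZMod 2) (ClusterManifold.F2Space (Fin m) (Fin k)),
      (∀ (i : Fin m) (j : Fin m ⊕ Fin k),
        η (ClusterManifold.e j) (ClusterManifold.e (Sum.inl i)) =
          (((ClusterManifold.seedAt Z v).Z i j : ℤ) : ZMod 2)) →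
      Finite (ConnectedComponents (ClusterManifold.regularPart Z)) ∧
        ClusterManifold.numComponents Z = ClusterManifold.numOrbits η) ∧
    ((∀ i, Odd (d i)) →
      ∀ Z' : Matrix (Fin m ⊕ Fin k) (Fin m ⊕ Fin k) ℤ,
        ClusterManifold.IsSquareExtension d (ClusterManifold.seedAt Z v).Z Z' →
      ∀ η : LinearMap.BilinForm (ZMod 2) (ClusterManifold.F2Space (Fin m) (Fin k)),
        (∀ i j : Fin m ⊕ Fin k, η (ClusterManifold.e i) (ClusterManifold.e j) =
          (((ClusterManifold.dHat d i : ℤ) * Z' i j : ℤ) : ZMod 2)) →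
        ClusterManifold.numComponents Z = ClusterManifold.numOrbits η) := by

  refine ⟨fun η hη => ⟨ClusterManifold.finite_connectedComponents hd hZ,
    ClusterManifold.numComponents_eq_numOrbits hd hZ v hη⟩, fun hodd Z' hZ' η hη => ?_⟩
  exact ClusterManifold.numComponents_eq_numOrbits hd hZ v fun i j =>
    (hη j (Sum.inl i)).trans (hZ'.cast_eq hodd i j)
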